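/- **Setting (perturbed Kepler problem in Poincaré coordinates).** Let $U:\mathbb R\times\mathbb R^2\to\mathbb R$ be $2\pi$-periodic in $t$ and of class $C^{0,3}$, i.e. the partial derivatives $\partial_x^\alpha U$, $|\alpha|\le 3$, exist and are continuous in $(t,x)$. For $\Lambda>0$, $\eta^2+\xi^2<2\Lambda$ and $\lambda\in\mathbb R$ (an angle, taken modulo $2\pi$) let $$x(\lambda,\Lambda,\eta,\xi)=R[g]\begin{pmatrix}a(\cos u-e)\\ a\sqrt{1-e^2}\,\sin u\end{pmatrix},\qquad u-e\sin u=l,$$ where $R[g]$ is the rotation of angle $g$ and $a,e,l,g$ are determined by $$\Lambda=\sqrt a,\quad \lambda=l+g,\quad \eta=\sqrt{2H}\,\sin h,\quad \xi=\sqrt{2H}\,\cos h,\quad h=-g,\quad H=\Lambda-\sqrt{a(1-e^2)}$$ (if $\eta=\xi=0$, then $e=0$ and $x=\Lambda^2(\cos\lambda,\sin\lambda)$). Put $\mathcal U(t,\lambda,\Lambda,\eta,\xi)=U(t,x(\lambda,\Lambda,\eta,\xi))$ and consider $$\dot\lambda=\frac1{\Lambda^3}-\varepsilon\,\partial_\Lambda\mathcal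 U,\qquad \dot\Lambda=\varepsilon\,\partial_\lambda\mathcal U,\qquad \dot\eta=-\varepsilon\,\partial_\xi\mathcal U,\qquad \dot\xi=\varepsilon\,\partial_\eta\mathcal U. \tag{1}$$ For an integer $N\ge1$ let $$\gamma_N(\lambda,\eta,\xi)=\frac1{2\pi}\int_0^{2\pi}\mathcal U\bigl(t,Nt+\lambda,N^{-1/3},\eta,\xi\bigr)\,dt,\qquad \eta^2+\xi^2<2N^{-1/3}.$$ **Proposition.** (a) Let $(\lambda_0,\eta_0,\xi_0)$, $\eta_0^2+\xi_0^2<2N^{-1/3}$, be a non-degenerate critical point of $\gamma_N$, i.e. $\nabla\gamma_N=0$ and $\det D^2\gamma_N\ne0$ there. Then there are $\delta>0$ and functions $\lambda(t,\varepsilon),\Lambda(t,\varepsilon),\eta(t,\varepsilon),\xi(t,\varepsilon)$ of class $C^1$ on $\mathbb R\times(-\delta,\delta)$ such that for each $|\varepsilon|<\delta$ they solve (1) for all $t$ inside the domain $\Lambda>0$, $\eta^2+\xi^2<2\Lambda$ and are $2\pi$-periodic in $t$ ($\lambda$ being an angle with $\lambda(t+2\pi,\varepsilon)=\lambda(t,\varepsilon)+2\pi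 N$), and $$\lambda(t,0)=Nt+\lambda_0,\quad \Lambda(t,0)=N^{-1/3},\quad \eta(t,0)=\eta_0,\quad \xi(t,0)=\xi_0 .$$ (b) The same holds for general degenerate Hamiltonians. Let $d\ge0$, let $I\subset\mathbb R$ be an open interval, let $D_r\subset\mathbb R^d\times\mathbb R^d$ ($r\in I$) be such that $\Omega=\{(\theta,q,r,p): \theta\in\mathbb R,\ r\in I,\ (q,p)\in D_r\}$ is open, let $h\in C^3(I)$ and let $\mathcal U:\mathbb R\times\Omega\to\mathbb R$ be of class $C^{0,3}$ (the partial derivatives in $(\theta,q,r,p)$ up to order three exist and are continuous on $\mathbb R\times\Omega$) and $2\pi$-periodic in $t$ and in $\theta$. Let $N\in\mathbb Z$ and $r_N\in I$ with $h'(r_N)=N$ and $h''(r_N)\neq0$, and let $(\theta_0,q_0,p_0)$ with $(q_0,p_0)\in D_{r_N}$ be a non-degenerate critical point of $$\mathcal U_\#(\theta,q,p)=\frac1{2\pi}\int_0^{2\pi}\mathcal U(t,\theta+Nt,q,r_N,p)\,dt .$$ Then there are $\delta>0$ and functions $(\theta,q,r,p)(t,\varepsilon)$ of class $C^1$ on $\mathbb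 R\times(-\delta,\delta)$ such that for each $|\varepsilon|<\delta$ they are, for all $t$, a solution in $\Omega$ of $$\dot\theta=h'(r)-\varepsilon\,\partial_r\mathcal U,\qquad \dot q=-\varepsilon\,\partial_p\mathcal U,\qquad \dot r=\varepsilon\,\partial_\theta\mathcal U,\qquad \dot p=\varepsilon\,\partial_q\mathcal U,$$ $2\pi$-periodic in $t$ ($\theta(t+2\pi,\varepsilon)=\theta(t,\varepsilon)+2\pi N$, the angle $\theta$ being lifted to $\mathbb R$), and $\theta(t,0)=\theta_0+Nt$, $q(t,0)=q_0$, $r(t,0)=r_N$, $p(t,0)=p_0$. -/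

import Mathlib

open Set

namespace DegenerateHamiltonian

/-! ### Regularity and non-degenerate critical points -/

/-- The class `C^{0,3}` on `ℝ × s`, for an open set `s`: the partial derivatives of `f (t, x)` with
respect to `x`, up to the third order, exist and are continuous functions of `(t, x)`. -/
def IsC03On {F : Type*} [NormedAddCommGroup F] [NormedSpace ℝ F]
    (f : ℝ → F → ℝ) (s : Set F) : Prop :=
  (∀ t, ContDiffOn ℝ 3 (f t) s) ∧
    ∀ k : ℕ, k ≤ 3 →
      ContinuousOn (fun y : ℝ × F => iteratedFDeriv ℝ k (f y.1) y.2) (univ ×ˢ s)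

/-- The Hessian `D² f (a)` as a bilinear form. -/
noncomputable def hessian {F : Type*} [NormedAddCommGroup F] [NormedSpace ℝ F]
    (f : F → ℝ) (a : F) : LinearMap.BilinForm ℝ F :=
  LinearMap.mk₂ ℝ (fun v w => fderiv ℝ (fderiv ℝ f) a v w)
    (by simp) (by simp) (by simp) (by simp)

/-- `a` is a non-degenerate critical point of `f`: `∇ f (a) = 0` and the Hessian matrix at `a` has
non-zero determinant. The determinant is taken in a basis of the (finite-dimensional) space; whether
it vanishes does not depend on the basis, see `hessian_det_ne_zero_iff`. -/
def IsNondegenerateCriticalPoint {F : Type*} [NormedAddCommGroup F] [NormedSpace ℝ F]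
    [FiniteDimensional ℝ F] (f : F → ℝ) (a : F) : Prop :=
  HasFDerivAt f (0 : F →L[ℝ] ℝ) a ∧
    (LinearMap.BilinForm.toMatrix (Module.finBasis ℝ F) (hessian f a)).det ≠ 0

theorem hessian_det_ne_zero_iff {F ι : Type*} [NormedAddCommGroup F] [NormedSpace ℝ F]
    [FiniteDimensional ℝ F] [Fintype ι] [DecidableEq ι] (b : Module.Basis ι ℝ F)
    (f : F → ℝ) (a : F) :
    (LinearMap.BilinForm.toMatrix (Module.finBasis ℝ F) (hessian f a)).det ≠ 0 ↔
      (Matrix.of fun i j => fderiv ℝ (fderiv ℝ f) a (b i) (b j)).det ≠ 0 := by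
  have h : (Matrix.of fun i j => fderiv ℝ (fderiv ℝ f) a (b i) (b j)) =
      LinearMap.BilinForm.toMatrix b (hessian f a) := by
    ext i j
    simp [hessian, LinearMap.BilinForm.toMatrix_apply]
  rw [h, ← LinearMap.BilinForm.nondegenerate_iff_det_ne_zero,
    ← LinearMap.BilinForm.nondegenerate_iff_det_ne_zero]

/-! ### Degenerate Hamiltonian systems `h(r) - ε 𝒰(t, θ, q, r, p)` -/

/-- Phase points `z = (θ, q, r, p)`, with the angle `θ` lifted to `ℝ`. -/
abbrev Phase (d : ℕ) : Type :=
  ℝ × EuclideanSpace ℝ (Fin d) × ℝ × EuclideanSpace ℝ (Fin d)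

/-- The (lifted) phase space `{(θ, q, r, p) : r ∈ I, (q, p) ∈ D_r}`. -/
def phaseSpace {d : ℕ} (I : Set ℝ)
    (D : ℝ → Set (EuclideanSpace ℝ (Fin d) × EuclideanSpace ℝ (Fin d))) : Set (Phase d) :=
  {z | z.2.2.1 ∈ I ∧ (z.2.1, z.2.2.2) ∈ D z.2.2.1}

/-- `(θ, q, r, p)` is a solution, defined on the whole line and contained in `Ω`, of
`θ' = h'(r) - ε ∂_r 𝒰`, `q' = - ε ∂_p 𝒰`, `r' = ε ∂_θ 𝒰`, `p' = ε ∂_q 𝒰`. -/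
structure IsSolution {d : ℕ} (Ω : Set (Phase d)) (h : ℝ → ℝ) (𝒰 : ℝ → Phase d → ℝ) (ε : ℝ)
    (θ : ℝ → ℝ) (q : ℝ → EuclideanSpace ℝ (Fin d)) (r : ℝ → ℝ)
    (p : ℝ → EuclideanSpace ℝ (Fin d)) : Prop where
  mem : ∀ t, (θ t, q t, r t, p t) ∈ Ω
  hasDerivAt_θ : ∀ t, HasDerivAt θ
    (deriv h (r t) - ε * deriv (fun s => 𝒰 t (θ t, q t, s, p t)) (r t)) t
  hasDerivAt_q : ∀ t, HasDerivAt q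
    (-(ε • gradient (fun s => 𝒰 t (θ t, q t, r t, s)) (p t))) t
  hasDerivAt_r : ∀ t, HasDerivAt r
    (ε * deriv (fun s => 𝒰 t (s, q t, r t, p t)) (θ t)) t
  hasDerivAt_p : ∀ t, HasDerivAt p
    (ε • gradient (fun s => 𝒰 t (θ t, s, r t, p t)) (q t)) t

/-- The averaged function
`𝒰_#(θ, q, p) = (1 / 2π) ∫₀^{2π} 𝒰(t, θ + N t, q, r_N, p) dt`. -/
noncomputable def averaged {d : ℕ} (𝒰 : ℝ → Phase d → ℝ) (N : ℤ) (rN : ℝ)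
    (w : ℝ × EuclideanSpace ℝ (Fin d) × EuclideanSpace ℝ (Fin d)) : ℝ :=
  1 / (2 * Real.pi) *
    ∫ t in (0 : ℝ)..(2 * Real.pi), 𝒰 t (w.1 + N * t, w.2.1, rN, w.2.2)

end DegenerateHamiltonian

namespace KeplerPoincare

/-! ### Poincaré coordinates for the planar Kepler problem -/

/-- Kepler's equation `u - e sin u = l` has exactly one solution `u` when `0 ≤ e < 1`. -/
theorem existsUnique_kepler_equation {e : ℝ} (he0 : 0 ≤ e) (he1 : e < 1) (l : ℝ) :
    ∃! u : ℝ, u - e * Real.sin u = l := by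
  have hs : ∀ u : ℝ, |e * Real.sin u| ≤ 1 := fun u => by
    rw [abs_mul, abs_of_nonneg he0]
    nlinarith [Real.abs_sin_le_one u, abs_nonneg (Real.sin u)]
  have hmono : StrictMono fun u : ℝ => u - e * Real.sin u := by
    apply strictMono_of_deriv_pos
    intro u
    have hd : HasDerivAt (fun u : ℝ => u - e * Real.sin u) (1 - e * Real.cos u) u :=
      (hasDerivAt_id u).sub ((Real.hasDerivAt_sin u).const_mul e)
    rw [hd.deriv]
    nlinarith [Real.cos_le_one u]
  have hc : Continuous fun u : ℝ => u - e * Real.sin u := by fun_prop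
  have hmem : l ∈ Icc ((fun u : ℝ => u - e * Real.sin u) (l - 1))
      ((fun u : ℝ => u - e * Real.sin u) (l + 1)) := by
    have h1 := abs_le.1 (hs (l - 1))
    have h2 := abs_le.1 (hs (l + 1))
    constructor <;> simp only <;> linarith
  obtain ⟨u, -, hu⟩ := intermediate_value_Icc (by linarith : l - 1 ≤ l + 1) hc.continuousOn hmem
  exact ⟨u, hu, fun v hv => hmono.injective (hv.trans hu.symm)⟩

/-- The eccentric anomaly `u = u(e, l)`: the solution of Kepler's equation `u - e sin u = l`, which
exists and is unique for `0 ≤ e < 1`. -/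
noncomputable def eccentricAnomaly (e l : ℝ) : ℝ :=
  Classical.epsilon fun u : ℝ => u - e * Real.sin u = l

theorem eccentricAnomaly_spec {e : ℝ} (he0 : 0 ≤ e) (he1 : e < 1) (l : ℝ) :
    eccentricAnomaly e l - e * Real.sin (eccentricAnomaly e l) = l :=
  Classical.epsilon_spec (existsUnique_kepler_equation he0 he1 l).exists

/-- The position on the Keplerian ellipse with major half-axis `a`, eccentricity `e`, mean anomaly
`l` and argument of the pericenter `g`:
`x = R[g] (a (cos u - e), a √(1 - e²) sin u)`, where `R[g]` is the rotation of angle `g`. -/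
noncomputable def ellipsePosition (a e l g : ℝ) : EuclideanSpace ℝ (Fin 2) :=
  let u := eccentricAnomaly e l
  let X := a * (Real.cos u - e)
  let Y := a * √(1 - e ^ 2) * Real.sin u
  !₂[Real.cos g * X - Real.sin g * Y, Real.sin g * X + Real.cos g * Y]

/-- The position in terms of the Delaunay variables, `L = √a`, `G = √(a (1 - e²))`. -/
noncomputable def delaunayPosition (L G l g : ℝ) : EuclideanSpace ℝ (Fin 2) :=
  ellipsePosition (L ^ 2) (√(1 - (G / L) ^ 2)) l g

/-- The position `x(λ, Λ, η, ξ)` in terms of the Poincaré coordinates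
`λ = l + g`, `Λ = L`, `η = √(2H) sin h`, `ξ = √(2H) cos h`, where `h = -g` and `H = L - G`.
So `H = (η² + ξ²) / 2` and `h` is the argument of `ξ + i η`. When `η = ξ = 0` the eccentricity is
zero and the value is `Λ² (cos λ, sin λ)`, see `position_circular`: this is the continuous extension
of the coordinates to circular motions. The angle `λ` is lifted to `ℝ`. -/
noncomputable def position (lam Lam eta xi : ℝ) : EuclideanSpace ℝ (Fin 2) :=
  let H := (eta ^ 2 + xi ^ 2) / 2
  let h := Complex.arg ⟨xi, eta⟩
  let g := -h
  delaunayPosition Lam (Lam - H) (lam - g) g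

theorem position_circular (lam : ℝ) {Lam : ℝ} (hL : 0 < Lam) :
    position lam Lam 0 0 = !₂[Lam ^ 2 * Real.cos lam, Lam ^ 2 * Real.sin lam] := by
  have h0 : (⟨0, 0⟩ : ℂ) = 0 := rfl
  have hu := eccentricAnomaly_spec le_rfl one_pos lam
  simp only [zero_mul, sub_zero] at hu
  simp [position, delaunayPosition, ellipsePosition, h0, hL.ne', hu]

/-- The domain `Λ > 0`, `η² + ξ² < 2Λ` of the Poincaré coordinates, with `λ` lifted to `ℝ`. -/
def domain : Set (ℝ × ℝ × ℝ × ℝ) :=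
  {z | 0 < z.2.1 ∧ z.2.2.1 ^ 2 + z.2.2.2 ^ 2 < 2 * z.2.1}

/-- The perturbing potential in Poincaré coordinates, `𝒰(t, λ, Λ, η, ξ) = U(t, x(λ, Λ, η, ξ))`. -/
noncomputable def potential (U : ℝ → EuclideanSpace ℝ (Fin 2) → ℝ) (t lam Lam eta xi : ℝ) : ℝ :=
  U t (position lam Lam eta xi)

/-- `(λ, Λ, η, ξ)` is a solution, defined on the whole line and contained in the domain of the
Poincaré coordinates, of the perturbed Kepler problem in these coordinates:
`λ' = 1/Λ³ - ε ∂_Λ 𝒰`, `Λ' = ε ∂_λ 𝒰`, `η' = - ε ∂_ξ 𝒰`, `ξ' = ε ∂_η 𝒰`. -/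
structure IsSolution (U : ℝ → EuclideanSpace ℝ (Fin 2) → ℝ) (ε : ℝ)
    (lam Lam eta xi : ℝ → ℝ) : Prop where
  mem : ∀ t, (lam t, Lam t, eta t, xi t) ∈ domain
  hasDerivAt_lam : ∀ t, HasDerivAt lam
    (1 / Lam t ^ 3 - ε * deriv (fun s => potential U t (lam t) s (eta t) (xi t)) (Lam t)) t
  hasDerivAt_Lam : ∀ t, HasDerivAt Lam
    (ε * deriv (fun s => potential U t s (Lam t) (eta t) (xi t)) (lam t)) t
  hasDerivAt_eta : ∀ t, HasDerivAt eta
    (-(ε * deriv (fun s => potential U t (lam t) (Lam t) (eta t) s) (xi t))) t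
  hasDerivAt_xi : ∀ t, HasDerivAt xi
    (ε * deriv (fun s => potential U t (lam t) (Lam t) s (xi t)) (eta t)) t

/-- The averaged potential
`γ_N(λ, η, ξ) = (1 / 2π) ∫₀^{2π} 𝒰(t, N t + λ, N^{-1/3}, η, ξ) dt`. -/
noncomputable def gammaN (U : ℝ → EuclideanSpace ℝ (Fin 2) → ℝ) (N : ℕ) (w : ℝ × ℝ × ℝ) : ℝ :=
  1 / (2 * Real.pi) *
    ∫ t in (0 : ℝ)..(2 * Real.pi),
      potential U t (N * t + w.1) (1 / (N : ℝ) ^ (1 / 3 : ℝ)) w.2.1 w.2.2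

end KeplerPoincare

/-! ### Superposition operators on spaces of continuous functions -/

namespace Superposition

open Filter Topology

variable {K E F : Type*} [TopologicalSpace K] [NormedAddCommGroup E] [NormedAddCommGroup F]

/-! In the rotating angle `θ - N t` the system becomes `w' = A(w) + ε G(t, w)`, where `A = (h'(r) -
N, 0, 0, 0)` and `G` is `2π`-periodic in `t`. At `ε = 0` every point with `r = r_N` is an
equilibrium, so periodic solutions come in a whole manifold and the implicit function theorem does
not apply directly. Let `Q` be the projection that forgets the `θ`-component, so that `Q ∘ A = 0`. A
loop `w` is a solution iff it is `w(0)` plus the primitive of the right-hand side and the mean of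
the right-hand side vanishes. The `Q`-part of that mean is `ε` times the `Q`-part of the mean of
`G`; dividing it by `ε` gives the map `periodicMap` on `ℝ × C(circle, E)`, which is still regular at
`ε = 0` and whose zeros are periodic solutions (`mean_eq_zero_of_periodicMap_eq_zero`).

At `ε = 0` a constant loop with `r = r_N` is a zero exactly when the mean of `Q G` vanishes, i.e. at
a critical point of the averaged function. Since `A'` is nilpotent there, invertibility of the
linearization reduces to injectivity of a linear map on `E` (`isInvertible_linearization`): `h'' ≠
0` forces the `r`-component of a kernel vector to vanish, and the non-degenerate Hessian kills the
others. The implicit function theorem then gives a `C¹` curve `ε ↦ ψ(ε)` of loops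
(`exists_periodic_family`), and `contDiffOn_uncurry` upgrades it to joint regularity in `(t, ε)`.
Working in the sup norm, superposition operators are `C¹` as soon as `G` is `C^{0,1}`
(`IsC01On.hasFDerivAt_superpos`).

The Kepler problem is the case `h(Λ) = -1/(2Λ²)`, once the position is known to be smooth in
Poincaré coordinates also at circular motions, where the Delaunay angles are singular. The cure is
the eccentric longitude `F = u + g`, which solves a Kepler equation whose coefficients `e cos g`, `e
sin g` are smooth in `(Λ, η, ξ)` (`eccentricLongitude_spec`, `position_eq`, `contDiffOn_position`).
-/

theorem continuous_apply_of_continuousOn {f : K → E → F} {s : Set E}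
    (hf : ContinuousOn (fun y : K × E => f y.1 y.2) (univ ×ˢ s)) {w : K → E}
    (hw : Continuous w) (hs : ∀ x, w x ∈ s) : Continuous fun x => f x (w x) :=
  hf.comp_continuous (continuous_id.prodMk hw) fun x => ⟨mem_univ _, hs x⟩

open Classical in
/-- The superposition operator `w ↦ f(·, w(·))`, with value zero if the result is discontinuous. -/
noncomputable def superpos (f : K → E → F) (w : C(K, E)) : C(K, F) :=
  if h : Continuous fun x => f x (w x) then ⟨fun x => f x (w x), h⟩ else 0

theorem superpos_apply {f : K → E → F} {s : Set E}
    (hf : ContinuousOn (fun y : K × E => f y.1 y.2) (univ ×ˢ s)) {w : C(K, E)}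
    (hs : ∀ x, w x ∈ s) (x : K) : superpos f w x = f x (w x) := by
  rw [superpos, dif_pos (continuous_apply_of_continuousOn hf w.continuous hs)]
  rfl

theorem isOpen_setOf_forall_mem [CompactSpace K] {s : Set E} (hs : IsOpen s) :
    IsOpen {w : C(K, E) | ∀ x, w x ∈ s} := by
  simpa [MapsTo] using ContinuousMap.isOpen_setOfPred_mapsTo (X := K) isCompact_univ hs

/-- In the compact-open topology it is enough that `(w, x) ↦ f(x, w(x))` be jointly continuous,
which follows from continuity of evaluation. -/
theorem continuousOn_superpos [CompactSpace K] {f : K → E → F} {s : Set E}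
    (hf : ContinuousOn (fun y : K × E => f y.1 y.2) (univ ×ˢ s)) :
    ContinuousOn (superpos f) {w : C(K, E) | ∀ x, w x ∈ s} := by
  apply ContinuousMap.continuousOn_of_continuousOn_uncurry
  have h : ContinuousOn (fun y : C(K, E) × K => f y.2 (y.1 y.2))
      ({w : C(K, E) | ∀ x, w x ∈ s} ×ˢ univ) :=
    hf.comp (f := fun y : C(K, E) × K => (y.2, y.1 y.2)) (by fun_prop)
      fun y hy => ⟨mem_univ _, hy.1 y.2⟩
  exact h.congr fun y hy => superpos_apply hf hy.1 y.2

variable [NormedSpace ℝ E] [NormedSpace ℝ F]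

/-- `f(x, z)` is differentiable in `z ∈ s`, and `f` and `∂_z f` are continuous on `K × s`. -/
structure IsC01On (f : K → E → F) (s : Set E) : Prop where
  differentiableAt : ∀ x, ∀ z ∈ s, DifferentiableAt ℝ (f x) z
  continuousOn : ContinuousOn (fun y : K × E => f y.1 y.2) (univ ×ˢ s)
  continuousOn_fderiv : ContinuousOn (fun y : K × E => fderiv ℝ (f y.1) y.2) (univ ×ˢ s)

variable [CompactSpace K]

/-- Pointwise application of operators, as a bilinear map. -/
noncomputable def pointwiseApply : C(K, E →L[ℝ] F) →L[ℝ] C(K, E) →L[ℝ] C(K, F) :=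
  LinearMap.mkContinuous₂
    (LinearMap.mk₂ ℝ (fun (T : C(K, E →L[ℝ] F)) (v : C(K, E)) =>
        (⟨fun x => T x (v x), by fun_prop⟩ : C(K, F)))
      (fun _ _ _ => by ext; simp) (fun _ _ _ => by ext; simp)
      (fun _ _ _ => by ext; simp) (fun _ _ _ => by ext; simp))
    1 (fun T v => by
      rw [one_mul]
      refine (ContinuousMap.norm_le _ (by positivity)).2 fun x => ?_
      exact (T x).le_of_opNorm_le_of_le (T.norm_coe_le_norm x) (v.norm_coe_le_norm x))

@[simp]
theorem pointwiseApply_apply (T : C(K, E →L[ℝ] F)) (v : C(K, E)) (x : K) :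
    pointwiseApply T v x = T x (v x) := rfl

/-- Continuity of `v ↦ ∂f(·, v(·))` in the sup norm makes the derivative vary by less than `c` on a
ball around `w`, uniformly in `x`. The mean value inequality on the segment from `w x` to `w x + v
x` then bounds the remainder by `c ‖v‖`. -/
theorem IsC01On.hasFDerivAt_superpos {f : K → E → F} {s : Set E} (hs : IsOpen s)
    (hf : IsC01On f s) {w : C(K, E)} (hw : ∀ x, w x ∈ s) :
    HasFDerivAt (superpos f) (pointwiseApply (superpos (fun x => fderiv ℝ (f x)) w)) w := by
  have hO := isOpen_setOf_forall_mem (K := K) hs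
  rw [hasFDerivAt_iff_isLittleO_nhds_zero, Asymptotics.isLittleO_iff]
  intro c hc
  have hD := (continuousOn_superpos (f := fun x => fderiv ℝ (f x))
    hf.continuousOn_fderiv).continuousAt (hO.mem_nhds hw)
  have h1 : ∀ᶠ v in 𝓝 w, v ∈ {w : C(K, E) | ∀ x, w x ∈ s} ∧
      dist (superpos (fun x => fderiv ℝ (f x)) v) (superpos (fun x => fderiv ℝ (f x)) w) < c :=
    Filter.Eventually.and (hO.mem_nhds hw) (hD (Metric.ball_mem_nhds _ hc))
  obtain ⟨r, hr, hball⟩ := Metric.eventually_nhds_iff_ball.1 h1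
  filter_upwards [Metric.ball_mem_nhds (0 : C(K, E)) hr] with v hv
  -- Convexity of the ball of loops keeps each segment inside `s`, although `s` need not be convex.
  have hmem : ∀ τ ∈ Icc (0 : ℝ) 1, w + τ • v ∈ Metric.ball w r := fun τ hτ => by
    rw [mem_ball_iff_norm, add_sub_cancel_left, norm_smul, Real.norm_of_nonneg hτ.1]
    have := mem_ball_zero_iff.1 hv
    nlinarith [norm_nonneg v, hτ.2]
  refine (ContinuousMap.norm_le _ (by positivity)).2 fun x => ?_
  have hv1 : ∀ y, (w + v) y ∈ s := by
    simpa using (hball _ (hmem 1 (by simp))).1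
  have key := Convex.norm_image_sub_le_of_norm_hasFDerivWithin_le' (𝕜 := ℝ) (f := f x)
    (f' := fun z => fderiv ℝ (f x) z) (φ := fderiv ℝ (f x) (w x)) (C := c)
    (s := segment ℝ (w x) (w x + v x)) (x := w x) (y := w x + v x) ?_ ?_
    (convex_segment _ _) (left_mem_segment ..) (right_mem_segment ..)
  · simp only [ContinuousMap.sub_apply, superpos_apply hf.continuousOn hv1,
      superpos_apply hf.continuousOn hw, pointwiseApply_apply,
      superpos_apply (f := fun x => fderiv ℝ (f x)) hf.continuousOn_fderiv hw]
    rw [add_sub_cancel_left] at key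
    exact key.trans (by gcongr; exact v.norm_coe_le_norm x)
  · intro z hz
    rw [segment_eq_image'] at hz
    obtain ⟨τ, hτ, rfl⟩ := hz
    have := (hball _ (hmem τ hτ)).1 x
    exact (hf.differentiableAt x _ (by simpa using this)).hasFDerivAt.hasFDerivWithinAt
  · intro z hz
    rw [segment_eq_image'] at hz
    obtain ⟨τ, hτ, rfl⟩ := hz
    obtain ⟨h2, h3⟩ := hball _ (hmem τ hτ)
    have h4 := (ContinuousMap.dist_apply_le_dist x).trans h3.le
    rw [superpos_apply (f := fun x => fderiv ℝ (f x)) hf.continuousOn_fderiv h2,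
      superpos_apply (f := fun x => fderiv ℝ (f x)) hf.continuousOn_fderiv hw,
      dist_eq_norm] at h4
    simpa using h4

theorem IsC01On.contDiffAt_superpos {f : K → E → F} {s : Set E} (hs : IsOpen s)
    (hf : IsC01On f s) {w : C(K, E)} (hw : ∀ x, w x ∈ s) :
    ContDiffAt ℝ 1 (superpos f) w := by
  rw [contDiffAt_one_iff]
  exact ⟨_, _, (isOpen_setOf_forall_mem hs).mem_nhds hw,
    pointwiseApply.continuous.comp_continuousOn (continuousOn_superpos
      (f := fun x => fderiv ℝ (f x)) hf.continuousOn_fderiv),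
    fun v hv => hf.hasFDerivAt_superpos hs hv⟩

end Superposition

/-! ### Mean value and primitives of periodic functions -/

namespace PeriodicFunction

open Filter Topology

theorem continuous_lift {T : ℝ} {E : Type*} [TopologicalSpace E]
    (v : C(AddCircle T, E)) : Continuous fun t : ℝ => v t :=
  v.continuous.comp (AddCircle.continuous_mk' T)

variable {T : ℝ} [hT : Fact (0 < T)] {E : Type*} [NormedAddCommGroup E] [NormedSpace ℝ E]

theorem norm_integral_le (v : C(AddCircle T, E)) (t : ℝ) :
    ‖∫ s in (0 : ℝ)..t, v s‖ ≤ ‖v‖ * |t| := by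
  simpa using intervalIntegral.norm_integral_le_of_norm_le_const (a := 0) (b := t)
    (f := fun s : ℝ => v s) fun s _ => v.norm_coe_le_norm s

/-- The mean value of a continuous function on the circle. -/
noncomputable def mean : C(AddCircle T, E) →L[ℝ] E :=
  LinearMap.mkContinuous
    { toFun := fun v => T⁻¹ • ∫ t in (0 : ℝ)..T, v t
      map_add' := fun u v => by
        simp only [ContinuousMap.add_apply]
        rw [intervalIntegral.integral_add ((continuous_lift u).intervalIntegrable _ _)
          ((continuous_lift v).intervalIntegrable _ _), smul_add]
      map_smul' := fun c v => by
        simp only [ContinuousMap.smul_apply, RingHom.id_apply]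
        rw [intervalIntegral.integral_smul, smul_comm] }
    1 (fun v => by
      have h := norm_integral_le v T
      have h0 := hT.out
      simp only [LinearMap.coe_mk, AddHom.coe_mk, norm_smul, norm_inv, Real.norm_eq_abs]
      rw [abs_of_pos h0] at *
      calc T⁻¹ * ‖∫ t in (0 : ℝ)..T, v t‖ ≤ T⁻¹ * (‖v‖ * T) := by gcongr
        _ = 1 * ‖v‖ := by field_simp)

theorem mean_apply (v : C(AddCircle T, E)) : mean v = T⁻¹ • ∫ t in (0 : ℝ)..T, v t := rfl

variable [CompleteSpace E]

theorem mean_const (c : E) : mean (ContinuousMap.const (AddCircle T) c) = c := by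
  simp [mean_apply, smul_smul, inv_mul_cancel₀ hT.out.ne']

theorem mean_comp {F : Type*} [NormedAddCommGroup F] [NormedSpace ℝ F] [CompleteSpace F]
    (A : E →L[ℝ] F) (v : C(AddCircle T, E)) (u : C(AddCircle T, F)) (h : ∀ x, u x = A (v x)) :
    mean u = A (mean v) := by
  simp only [mean_apply, h, map_smul]
  rw [A.intervalIntegral_comp_comm ((continuous_lift v).intervalIntegrable _ _)]

theorem periodic_integral_sub_mean (v : C(AddCircle T, E)) :
    Function.Periodic (fun t : ℝ => ∫ s in (0 : ℝ)..t, (v s - mean v)) T := by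
  intro t
  have hc : Continuous fun s : ℝ => v s - mean v := (continuous_lift v).sub continuous_const
  have hp : Function.Periodic (fun s : ℝ => v s - mean v) T := fun s => by simp
  have h0 := hp.intervalIntegral_add_eq t 0
  have h1 : ∫ s in (0 : ℝ)..T, (v s - mean v) = 0 := by
    rw [intervalIntegral.integral_sub ((continuous_lift v).intervalIntegrable _ _) (by simp)]
    simp [mean_apply, smul_smul, inv_mul_cancel₀ hT.out.ne']
  rw [zero_add, h1] at h0
  simp only
  rw [← intervalIntegral.integral_add_adjacent_intervals (hc.intervalIntegrable 0 t)
    (hc.intervalIntegrable t (t + T)), h0, add_zero]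

/-- The primitive, vanishing at zero, of the oscillating part of `v`, as a function on the
circle. -/
noncomputable def primitiveFun (v : C(AddCircle T, E)) : C(AddCircle T, E) where
  toFun := (periodic_integral_sub_mean v).lift
  continuous_toFun := by
    refine continuous_quot_lift _ ?_
    have hc : Continuous fun s : ℝ => v s - mean v := (continuous_lift v).sub continuous_const
    exact intervalIntegral.continuous_primitive (fun a b => hc.intervalIntegrable a b) 0

theorem primitiveFun_coe (v : C(AddCircle T, E)) (t : ℝ) :
    primitiveFun v t = ∫ s in (0 : ℝ)..t, (v s - mean v) :=
  (periodic_integral_sub_mean v).lift_coe t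

theorem norm_primitiveFun_le (v : C(AddCircle T, E)) :
    ‖primitiveFun v‖ ≤ T * (1 + ‖(mean : C(AddCircle T, E) →L[ℝ] E)‖) * ‖v‖ := by
  have h0 := hT.out
  refine (ContinuousMap.norm_le _ (by positivity)).2 fun x => ?_
  obtain ⟨t, ht, rfl⟩ : ∃ t ∈ Ico 0 T, (t : AddCircle T) = x := by
    have := AddCircle.coe_image_Ico_eq (p := T) 0
    rw [zero_add] at this
    simpa using this.symm.subset (mem_univ x)
  rw [primitiveFun_coe]
  have h1 : ∀ s : ℝ, ‖v s - mean v‖ ≤ (1 + ‖(mean : C(AddCircle T, E) →L[ℝ] E)‖) * ‖v‖ :=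
    fun s => by
      refine (norm_sub_le _ _).trans ?_
      rw [add_mul, one_mul]
      exact add_le_add (v.norm_coe_le_norm _) (mean.le_opNorm v)
  have h2 := intervalIntegral.norm_integral_le_of_norm_le_const (a := 0) (b := t)
    (f := fun s : ℝ => v s - mean v) fun s _ => h1 s
  refine h2.trans ?_
  rw [sub_zero, abs_of_nonneg ht.1, mul_comm, mul_assoc]
  gcongr
  exact ht.2.le

/-- The primitive, vanishing at zero, of the oscillating part. -/
noncomputable def primitive : C(AddCircle T, E) →L[ℝ] C(AddCircle T, E) :=
  LinearMap.mkContinuous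
    { toFun := primitiveFun
      map_add' := fun u v => by
        ext x
        induction x using QuotientAddGroup.induction_on with | _ t => ?_
        have hc : ∀ w : C(AddCircle T, E), Continuous fun s : ℝ => w s - mean w :=
          fun w => (continuous_lift w).sub continuous_const
        simp only [primitiveFun_coe, ContinuousMap.add_apply, map_add]
        rw [← intervalIntegral.integral_add ((hc u).intervalIntegrable _ _)
          ((hc v).intervalIntegrable _ _)]
        congr 1; ext s; abel
      map_smul' := fun c v => by
        ext x
        induction x using QuotientAddGroup.induction_on with | _ t => ?_
        simp only [primitiveFun_coe, ContinuousMap.smul_apply, map_smul, RingHom.id_apply,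
          ← smul_sub]
        rw [intervalIntegral.integral_smul] }
    _ norm_primitiveFun_le

theorem primitive_coe (v : C(AddCircle T, E)) (t : ℝ) :
    primitive v t = ∫ s in (0 : ℝ)..t, (v s - mean v) := primitiveFun_coe v t

theorem primitive_zero (v : C(AddCircle T, E)) : primitive v 0 = 0 := by
  have := primitive_coe v 0
  simpa using this

theorem primitive_const (c : E) : primitive (ContinuousMap.const (AddCircle T) c) = 0 := by
  ext x
  induction x using QuotientAddGroup.induction_on with | _ t => ?_
  rw [primitive_coe]
  simp [mean_const]

theorem primitive_comp {F : Type*} [NormedAddCommGroup F] [NormedSpace ℝ F] [CompleteSpace F]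
    (A : E →L[ℝ] F) (v : C(AddCircle T, E)) (u : C(AddCircle T, F)) (h : ∀ x, u x = A (v x))
    (x : AddCircle T) : primitive u x = A (primitive v x) := by
  induction x using QuotientAddGroup.induction_on with | _ t => ?_
  have hc : Continuous fun s : ℝ => v s - mean v := (continuous_lift v).sub continuous_const
  rw [primitive_coe, primitive_coe, ← A.intervalIntegral_comp_comm (hc.intervalIntegrable _ _)]
  simp only [map_sub, h, mean_comp A v u h]

theorem hasDerivAt_primitive (v : C(AddCircle T, E)) (t : ℝ) :
    HasDerivAt (fun t : ℝ => primitive v t) (v t - mean v) t := by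
  have hc : Continuous fun s : ℝ => v s - mean v := (continuous_lift v).sub continuous_const
  simp only [primitive_coe]
  exact hc.integral_hasStrictDerivAt 0 t |>.hasDerivAt

end PeriodicFunction

/-! ### Periodic solutions by the implicit function theorem -/

namespace PeriodicFunction

open Filter Topology Superposition

variable {T : ℝ} [hT : Fact (0 < T)] {E : Type*} [NormedAddCommGroup E] [NormedSpace ℝ E]

/-- Constant functions, as a continuous linear map. -/
noncomputable def constL : E →L[ℝ] C(AddCircle T, E) :=
  LinearMap.mkContinuous
    { toFun := ContinuousMap.const (AddCircle T)
      map_add' := fun _ _ => rfl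
      map_smul' := fun _ _ => rfl } 1
    (fun c => (ContinuousMap.norm_le _ (by positivity)).2 fun _ => by
      rw [one_mul]; exact le_rfl)

theorem constL_eq (c : E) : constL c = ContinuousMap.const (AddCircle T) c := rfl

@[simp]
theorem constL_apply (c : E) (x : AddCircle T) : constL c x = c := rfl

/-- Both partial derivatives exist and are jointly continuous: in `t` it is `V`, and in `ε` it is
the value at `t` of `ψ'(ε)`, because evaluation of a loop at a point is linear in the loop and
jointly continuous. -/
theorem contDiffOn_uncurry {ψ : ℝ → C(AddCircle T, E)} {V : ℝ → ℝ → E} {S : Set ℝ}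
    (hS : IsOpen S) (hψ : ContDiffOn ℝ 1 ψ S)
    (hV : ContinuousOn (fun y : ℝ × ℝ => V y.1 y.2) (univ ×ˢ S))
    (hd : ∀ ε ∈ S, ∀ t : ℝ, HasDerivAt (fun t : ℝ => ψ ε t) (V t ε) t) :
    ContDiffOn ℝ 1 (fun y : ℝ × ℝ => ψ y.2 y.1) (univ ×ˢ S) := by
  have hO : IsOpen ((univ : Set ℝ) ×ˢ S) := isOpen_univ.prod hS
  let f₁ : ℝ → ℝ → ℝ →L[ℝ] E := fun t ε => ContinuousLinearMap.toSpanSingleton ℝ (V t ε)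
  let f₂ : ℝ → ℝ → ℝ →L[ℝ] E := fun t ε =>
    (ContinuousMap.evalCLM ℝ (t : AddCircle T)).comp (fderiv ℝ ψ ε)
  have hc₁ : ContinuousOn (fun y : ℝ × ℝ => f₁ y.1 y.2) (univ ×ˢ S) :=
    (ContinuousLinearMap.toSpanSingletonCLE (𝕜 := ℝ) (E := E)).continuous.comp_continuousOn hV
  have hfd : ContinuousOn (fderiv ℝ ψ) S := hψ.continuousOn_fderiv_of_isOpen hS le_rfl
  have hc₂ : ContinuousOn (fun y : ℝ × ℝ => f₂ y.1 y.2) (univ ×ˢ S) := by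
    have h1 : ∀ y : ℝ × ℝ, f₂ y.1 y.2 = ContinuousLinearMap.toSpanSingleton ℝ
        ((fderiv ℝ ψ y.2 1) (y.1 : AddCircle T)) := fun y => by
      ext; simp [f₂]
    simp only [h1]
    refine (ContinuousLinearMap.toSpanSingletonCLE (𝕜 := ℝ) (E := E)).continuous.comp_continuousOn ?_
    have h2 : ContinuousOn (fun y : ℝ × ℝ => fderiv ℝ ψ y.2 1) (univ ×ˢ S) :=
      (hfd.clm_apply continuousOn_const).comp continuousOn_snd fun y hy => hy.2
    have h3 : Continuous fun y : ℝ × ℝ => (y.1 : AddCircle T) :=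
      (AddCircle.continuous_mk' T).comp continuous_fst
    exact ContinuousEval.continuous_eval.comp_continuousOn (h2.prodMk h3.continuousOn)
  intro y hy
  apply ContDiffAt.contDiffWithinAt
  rw [contDiffAt_one_iff]
  refine ⟨fun y => (f₁ y.1 y.2).coprod (f₂ y.1 y.2), univ ×ˢ S, hO.mem_nhds hy, ?_, ?_⟩
  · have h := (hc₁.clm_comp (continuousOn_const (c := ContinuousLinearMap.fst ℝ ℝ ℝ))).add
      (hc₂.clm_comp (continuousOn_const (c := ContinuousLinearMap.snd ℝ ℝ ℝ)))
    exact h.congr fun y _ => by ext <;> simp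
  · intro z hz
    have hev := hO.eventually_mem hz
    exact (hasStrictFDerivAt_uncurry_coprod (f := fun t ε : ℝ => ψ ε t) (f₁ := f₁) (f₂ := f₂)
      (hev.mono fun v hv => (hd v.2 hv.2 v.1).hasFDerivAt)
      (hev.mono fun v hv =>
        (ContinuousMap.evalCLM ℝ (M := E) (v.1 : AddCircle T)).hasFDerivAt.comp v.2
          ((hψ.differentiableOn one_ne_zero).differentiableAt (hS.mem_nhds hv.2)).hasFDerivAt)
      (hc₁.continuousAt (hO.mem_nhds hz)) (hc₂.continuousAt (hO.mem_nhds hz))).hasFDerivAt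

variable [FiniteDimensional ℝ E]

/-- Because `R² = 0` and `R` commutes with taking primitives, the non-constant part of `L v = g` is
solved explicitly. What remains is a finite-dimensional equation for a constant, governed by `R + Q
∘ mean D`. Continuity of the inverse comes from the open mapping theorem. -/
theorem isInvertible_linearization
    (R Q : E →L[ℝ] E) (D : C(AddCircle T, E →L[ℝ] E))
    (L : C(AddCircle T, E) →L[ℝ] C(AddCircle T, E))
    (hR : R.comp R = 0)
    (hL : ∀ v : C(AddCircle T, E), L v = v - constL (v 0) -
      primitive (pointwiseApply (constL (T := T) R) v) +
      constL (mean (pointwiseApply (constL (T := T) R) v) + Q (mean (pointwiseApply D v))))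
    (hinj : ∀ c, R c + Q (mean D c) = 0 → c = 0) : L.IsInvertible := by
  have hcomp : CompleteSpace E := FiniteDimensional.complete ℝ E
  have hRR : ∀ c, R (R c) = 0 := fun c => congrArg (fun A => A c) hR
  have hprim : ∀ (v : C(AddCircle T, E)) (x : AddCircle T),
      primitive (pointwiseApply (constL R) v) x = R (primitive v x) :=
    fun v x => primitive_comp R v _ (fun _ => rfl) x
  have hmR : ∀ v : C(AddCircle T, E), mean (pointwiseApply (constL R) v) = R (mean v) :=
    fun v => mean_comp R v _ fun _ => rfl
  have hmD : ∀ c : E, mean (pointwiseApply D (constL c)) = mean D c := fun c =>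
    mean_comp (ContinuousLinearMap.apply ℝ E c) D _ fun _ => rfl
  have hker : ∀ v, L v = 0 → v = 0 := by
    intro v hv
    rw [hL] at hv
    have h0 : mean (pointwiseApply (constL (T := T) R) v) + Q (mean (pointwiseApply D v)) = 0 := by
      simpa [primitive_zero] using congrArg (fun u : C(AddCircle T, E) => u 0) hv
    rw [h0, (constL (T := T) (E := E)).map_zero, add_zero, sub_eq_zero] at hv
    -- A kernel element differs from `v 0` by values of `R`, so `R v` is constant; its primitive
    -- vanishes, hence `v` is itself constant and `hinj` applies.
    have h1 : ∀ x, v x = v 0 + R (primitive v x) := fun x => by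
      have := congrArg (fun u : C(AddCircle T, E) => u x) hv
      simp only [ContinuousMap.sub_apply, constL_apply, hprim] at this
      rw [← this]; abel
    have h2 : pointwiseApply (constL R) v = constL (R (v 0)) := by
      ext x
      simp only [pointwiseApply_apply, constL_apply]
      rw [h1 x, map_add, hRR, add_zero]
    have h3 : v = constL (v 0) := by
      rw [h2, constL_eq (R (v 0)), primitive_const, sub_eq_zero] at hv
      exact hv
    have h4 : v 0 = 0 := by
      apply hinj
      rw [h3, hmD, hmR, constL_eq, mean_const] at h0
      simpa using h0
    rw [h3, h4, (constL (T := T) (E := E)).map_zero]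
  have hsurj : Function.Surjective L := by
    intro g
    let M : E →L[ℝ] E := R + Q.comp (mean D)
    have hMinj : Function.Injective M := (injective_iff_map_eq_zero M).2 fun c hc => hinj c hc
    have hMsurj : Function.Surjective M :=
      LinearMap.injective_iff_surjective (f := (M : E →ₗ[ℝ] E)).1 hMinj
    -- This `u` solves `u - primitive (R u) = g - g 0` with `u 0 = 0`, again by `R² = 0`. The
    -- constant `c` is then chosen to correct the constant part.
    let u : C(AddCircle T, E) := g - constL (g 0) + primitive (pointwiseApply (constL R) g)
    obtain ⟨c, hc⟩ := hMsurj (g 0 -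
      (mean (pointwiseApply (constL R) u) + Q (mean (pointwiseApply D u))))
    have hu0 : u 0 = 0 := by simp [u, primitive_zero]
    have hpu : primitive (pointwiseApply (constL R) u) = primitive (pointwiseApply (constL R) g) := by
      ext x
      rw [hprim, hprim]
      have h1 : primitive u x = primitive g x + R (primitive (primitive g) x) := by
        simp only [u, map_add, map_sub, constL_eq (g 0), primitive_const, sub_zero,
          ContinuousMap.add_apply]
        rw [primitive_comp R (primitive g) _ (hprim g)]
      rw [h1, map_add, hRR, add_zero]
    have hpc : primitive (pointwiseApply (constL (T := T) R) (constL c)) = 0 := by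
      have : pointwiseApply (constL R) (constL c) = constL (T := T) (R c) := rfl
      rw [this, constL_eq, primitive_const]
    refine ⟨constL c + u, ?_⟩
    have hc' : R c + Q (mean D c) = g 0 -
      (mean (pointwiseApply (constL R) u) + Q (mean (pointwiseApply D u))) := hc
    have hmRc : mean (pointwiseApply (constL R) (constL (T := T) c)) = R c := by
      rw [hmR, constL_eq, mean_const]
    rw [hL]
    simp only [map_add, hpc, hpu, hmRc, hmD, ContinuousMap.add_apply, constL_apply, hu0, add_zero,
      zero_add]
    have h5 : constL (T := T) (g 0) = constL (T := T) (R c + Q (mean D c)) + constL (T := T)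
        (mean (pointwiseApply (constL R) u) + Q (mean (pointwiseApply D u))) := by
      rw [← map_add, hc', sub_add_cancel]
    have h6 : u = g - constL (g 0) + primitive (pointwiseApply (constL R) g) := rfl
    rw [map_add, map_add] at h5
    calc _ = u - primitive (pointwiseApply (constL R) g) + (constL (T := T) (R c) + constL (Q (mean D c)) +
          (constL (mean (pointwiseApply (constL R) u)) +
            constL (Q (mean (pointwiseApply D u))))) := by abel
      _ = g := by rw [← h5, h6]; abel
  exact ⟨ContinuousLinearEquiv.ofBijective L (LinearMap.ker_eq_bot'.2 hker)
    (LinearMap.range_eq_top.2 hsurj), by ext; rfl⟩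

end PeriodicFunction

namespace PeriodicFunction

open Filter Topology Superposition

variable {T : ℝ} [hT : Fact (0 < T)] {E : Type*} [NormedAddCommGroup E] [NormedSpace ℝ E]

/-- The map whose zeros are the `T`-periodic solutions of `w' = A(w) + ε G(t, w)`, provided that
`Q` is a projection with `Q ∘ A = 0`. -/
noncomputable def periodicMap (A : E → E) (G : AddCircle T → E → E) (Q : E →L[ℝ] E)
    [CompleteSpace E] (y : ℝ × C(AddCircle T, E)) : C(AddCircle T, E) :=
  y.2 - constL (y.2 0) -
    primitive (superpos (fun _ => A) y.2 + y.1 • superpos G y.2) +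
    constL (mean (superpos (fun _ => A) y.2) +
      y.1 • (mean (superpos G y.2) - Q (mean (superpos G y.2))) + Q (mean (superpos G y.2)))

/-- Evaluation at `0` isolates the constant term of `periodicMap`. Applying `Q` leaves `Q (mean G) =
0`, valid even for `ε = 0`; after this the constant term is the true mean of `A + ε G`. -/
theorem mean_eq_zero_of_periodicMap_eq_zero [CompleteSpace E] {A : E → E}
    {G : AddCircle T → E → E} {Q : E →L[ℝ] E} {ε : ℝ} {w : C(AddCircle T, E)}
    (hQ : ∀ c, Q (Q c) = Q c) (hQA : Q (mean (superpos (fun _ => A) w)) = 0)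
    (h : periodicMap A G Q (ε, w) = 0) :
    mean (superpos (fun _ => A) w + ε • superpos G w) = 0 ∧
      w = constL (w 0) + primitive (superpos (fun _ => A) w + ε • superpos G w) := by
  have h0 := congrArg (fun u : C(AddCircle T, E) => u 0) h
  simp only [periodicMap, ContinuousMap.add_apply, ContinuousMap.sub_apply, constL_apply,
    sub_self, primitive_zero, zero_add, ContinuousMap.zero_apply] at h0
  have h1 : Q (mean (superpos G w)) = 0 := by
    simpa [hQA, hQ] using congrArg Q h0
  rw [periodicMap] at h
  simp only [h0, map_zero, add_zero] at h
  refine ⟨?_, ?_⟩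
  · rw [h1, sub_zero, add_zero] at h0
    simpa using h0
  · rwa [sub_sub, sub_eq_zero] at h

theorem contDiffAt_periodicMap [CompleteSpace E] {Ω : Set E} (hΩ : IsOpen Ω)
    {A : E → E} {G : AddCircle T → E → E} {Q : E →L[ℝ] E}
    (hA : IsC01On (fun _ : AddCircle T => A) Ω) (hG : IsC01On G Ω) (ε : ℝ)
    {w : C(AddCircle T, E)} (hw : ∀ x, w x ∈ Ω) :
    ContDiffAt ℝ 1 (periodicMap A G Q) (ε, w) := by
  have hcA : ContDiffAt ℝ 1 (fun y : ℝ × C(AddCircle T, E) => superpos (fun _ => A) y.2)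
      (ε, w) := (hA.contDiffAt_superpos hΩ hw).comp (ε, w) contDiffAt_snd
  have hcG : ContDiffAt ℝ 1 (fun y : ℝ × C(AddCircle T, E) => superpos G y.2)
      (ε, w) := (hG.contDiffAt_superpos hΩ hw).comp (ε, w) contDiffAt_snd
  have hκ : ContDiffAt ℝ 1 (fun y : ℝ × C(AddCircle T, E) => constL (T := T) (y.2 0)) (ε, w) :=
    ContDiffAt.continuousLinearMap_comp (f := fun y : ℝ × C(AddCircle T, E) => y.2)
      ((constL (T := T) (E := E)).comp (ContinuousMap.evalCLM ℝ (M := E) (0 : AddCircle T)))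
      contDiffAt_snd
  have hp : ContDiffAt ℝ 1 (fun y : ℝ × C(AddCircle T, E) =>
      primitive (superpos (fun _ => A) y.2 + y.1 • superpos G y.2)) (ε, w) :=
    (hcA.add (contDiffAt_fst.smul hcG)).continuousLinearMap_comp (primitive (T := T) (E := E))
  have hmA : ContDiffAt ℝ 1 (fun y : ℝ × C(AddCircle T, E) => mean (superpos (fun _ => A) y.2))
      (ε, w) := hcA.continuousLinearMap_comp (mean (T := T) (E := E))
  have hmG : ContDiffAt ℝ 1 (fun y : ℝ × C(AddCircle T, E) => mean (superpos G y.2))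
      (ε, w) := hcG.continuousLinearMap_comp (mean (T := T) (E := E))
  have hqG : ContDiffAt ℝ 1 (fun y : ℝ × C(AddCircle T, E) => Q (mean (superpos G y.2)))
      (ε, w) := hmG.continuousLinearMap_comp Q
  have hc : ContDiffAt ℝ 1 (fun y : ℝ × C(AddCircle T, E) => constL (T := T)
      (mean (superpos (fun _ => A) y.2) +
      y.1 • (mean (superpos G y.2) - Q (mean (superpos G y.2))) + Q (mean (superpos G y.2))))
      (ε, w) :=
    ((hmA.add (contDiffAt_fst.smul (hmG.sub hqG))).add hqG).continuousLinearMap_comp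
      (constL (T := T) (E := E))
  exact ((contDiffAt_snd.sub hκ).sub hp).add hc

theorem hasFDerivAt_periodicMap_zero [CompleteSpace E] {Ω : Set E} (hΩ : IsOpen Ω)
    {A : E → E} {G : AddCircle T → E → E} {Q : E →L[ℝ] E}
    (hA : IsC01On (fun _ : AddCircle T => A) Ω) (hG : IsC01On G Ω)
    {w : C(AddCircle T, E)} (hw : ∀ x, w x ∈ Ω) :
    HasFDerivAt (fun w => periodicMap A G Q (0, w))
      (.id ℝ _ - constL.comp (ContinuousMap.evalCLM ℝ (0 : AddCircle T)) -
        primitive.comp (pointwiseApply (superpos (fun _ => fderiv ℝ A) w)) +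
        constL.comp (mean.comp (pointwiseApply (superpos (fun _ => fderiv ℝ A) w)) +
          Q.comp (mean.comp (pointwiseApply (superpos (fun x => fderiv ℝ (G x)) w))))) w := by
  have hdA := hA.hasFDerivAt_superpos hΩ hw
  have hdG := hG.hasFDerivAt_superpos hΩ hw
  have hev : HasFDerivAt (fun w : C(AddCircle T, E) => constL (T := T) (w 0))
      (constL.comp (ContinuousMap.evalCLM ℝ (0 : AddCircle T))) w :=
    ((constL (T := T) (E := E)).comp (ContinuousMap.evalCLM ℝ (M := E) (0 : AddCircle T))).hasFDerivAt
  have hp : HasFDerivAt (fun w : C(AddCircle T, E) => primitive (superpos (fun _ => A) w))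
      (primitive.comp (pointwiseApply (superpos (fun _ => fderiv ℝ A) w))) w :=
    (primitive (T := T) (E := E)).hasFDerivAt.comp w hdA
  have hmA : HasFDerivAt (fun w : C(AddCircle T, E) => mean (superpos (fun _ => A) w))
      (mean.comp (pointwiseApply (superpos (fun _ => fderiv ℝ A) w))) w :=
    (mean (T := T) (E := E)).hasFDerivAt.comp w hdA
  have hmG : HasFDerivAt (fun w : C(AddCircle T, E) => Q (mean (superpos G w)))
      (Q.comp (mean.comp (pointwiseApply (superpos (fun x => fderiv ℝ (G x)) w)))) w :=
    Q.hasFDerivAt.comp w ((mean (T := T) (E := E)).hasFDerivAt.comp w hdG)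
  have hc : HasFDerivAt (fun w : C(AddCircle T, E) => constL (T := T)
      (mean (superpos (fun _ => A) w) + Q (mean (superpos G w)))) _ w :=
    (constL (T := T) (E := E)).hasFDerivAt.comp w (hmA.add hmG)
  simp only [periodicMap, zero_smul, add_zero]
  exact (((hasFDerivAt_id w).sub hev).sub hp).add hc

/-- The implicit function theorem for `periodicMap` at `(0, w₀)`, with `w₀` regarded as a constant
loop. -/
theorem exists_periodic_family [FiniteDimensional ℝ E] {Ω : Set E} (hΩ : IsOpen Ω)
    {A : E → E} {G : AddCircle T → E → E} {Q : E →L[ℝ] E}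
    (hA : IsC01On (fun _ : AddCircle T => A) Ω) (hG : IsC01On G Ω)
    (hQ : ∀ c, Q (Q c) = Q c) (hQA : ∀ z ∈ Ω, Q (A z) = 0) {w₀ : E} (hw₀ : w₀ ∈ Ω)
    (hA₀ : A w₀ = 0) (hR : (fderiv ℝ A w₀).comp (fderiv ℝ A w₀) = 0)
    (hG₀ : Q (mean (superpos G (constL w₀))) = 0)
    (hinj : ∀ c, fderiv ℝ A w₀ c +
      Q (mean (superpos (fun x => fderiv ℝ (G x)) (constL w₀)) c) = 0 → c = 0) :
    ∃ δ : ℝ, 0 < δ ∧ ∃ W : ℝ → ℝ → E,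
      ContDiffOn ℝ 1 (fun y : ℝ × ℝ => W y.1 y.2) (univ ×ˢ Ioo (-δ) δ) ∧
      (∀ ε ∈ Ioo (-δ) δ, ∀ t, W t ε ∈ Ω ∧
        HasDerivAt (fun t => W t ε) (A (W t ε) + ε • G t (W t ε)) t ∧ W (t + T) ε = W t ε) ∧
      ∀ t, W t 0 = w₀ := by
  have hcomp : CompleteSpace E := FiniteDimensional.complete ℝ E
  have hmem₀ : ∀ x : AddCircle T, constL w₀ x ∈ Ω := fun _ => hw₀
  have hO := isOpen_setOf_forall_mem (K := AddCircle T) hΩ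
  have hΦ := contDiffAt_periodicMap (Q := Q) hΩ hA hG 0 hmem₀
  have hzero : superpos (fun _ : AddCircle T => A) (constL w₀) = 0 := by
    ext x
    rw [superpos_apply (f := fun _ : AddCircle T => A) hA.continuousOn hmem₀]
    simpa using hA₀
  have hΦ₀ : periodicMap A G Q (0, constL w₀) = 0 := by
    simp [periodicMap, hzero, hG₀]
  have hinv : (fderiv ℝ (periodicMap A G Q) (0, constL w₀) ∘L
      .inr ℝ ℝ C(AddCircle T, E)).IsInvertible := by
    refine isInvertible_linearization (fderiv ℝ A w₀) Q
      (superpos (fun x => fderiv ℝ (G x)) (constL w₀)) _ hR (fun v => ?_) hinj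
    have h1 : HasFDerivAt (fun w => periodicMap A G Q (0, w))
        (fderiv ℝ (periodicMap A G Q) (0, constL w₀) ∘L .inr ℝ ℝ C(AddCircle T, E))
        (constL w₀) :=
      (hΦ.differentiableAt one_ne_zero).hasFDerivAt.comp (constL w₀)
        (hasFDerivAt_prodMk_right 0 (constL w₀))
    have h2 := hasFDerivAt_periodicMap_zero (Q := Q) hΩ hA hG hmem₀
    rw [h1.unique h2]
    have h3 : superpos (fun _ : AddCircle T => fderiv ℝ A) (constL w₀) =
        constL (fderiv ℝ A w₀) := by
      ext1 x
      exact superpos_apply (f := fun _ : AddCircle T => fderiv ℝ A) hA.continuousOn_fderiv hmem₀ x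
    rw [h3]
    rfl
  set ψ := hΦ.implicitFunction one_ne_zero hinv
  have hψ₀ : ψ 0 = constL w₀ := hΦ.implicitFunction_apply_self one_ne_zero hinv
  have hψ : ContDiffAt ℝ 1 ψ 0 := hΦ.contDiffAt_implicitFunction one_ne_zero hinv
  have e1 : ∀ᶠ ε in 𝓝 (0 : ℝ), periodicMap A G Q (ε, ψ ε) = 0 := by
    have := hΦ.eventually_apply_implicitFunction one_ne_zero hinv
    rwa [hΦ₀] at this
  have e2 : ∀ᶠ ε in 𝓝 (0 : ℝ), ContDiffAt ℝ 1 ψ ε := hψ.eventually (by simp)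
  have e3 : ∀ᶠ ε in 𝓝 (0 : ℝ), ψ ε ∈ {w : C(AddCircle T, E) | ∀ x, w x ∈ Ω} :=
    hψ.continuousAt (by rw [hψ₀]; exact hO.mem_nhds hmem₀)
  obtain ⟨δ, hδ, hball⟩ := Metric.eventually_nhds_iff_ball.1 ((e1.and e2).and e3)
  rw [Real.ball_eq_Ioo, zero_sub, zero_add] at hball
  have hψc : ContDiffOn ℝ 1 ψ (Ioo (-δ) δ) := fun ε hε => (hball ε hε).1.2.contDiffWithinAt
  have hderiv : ∀ ε ∈ Ioo (-δ) δ, ∀ t : ℝ,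
      HasDerivAt (fun t : ℝ => ψ ε t) (A (ψ ε t) + ε • G t (ψ ε t)) t := by
    intro ε hε t
    obtain ⟨⟨h1, -⟩, h3⟩ := hball ε hε
    have hq : Q (mean (superpos (fun _ => A) (ψ ε))) = 0 := by
      rw [← mean_comp Q _ 0 fun x => ?_, map_zero]
      rw [superpos_apply (f := fun _ : AddCircle T => A) hA.continuousOn h3, hQA _ (h3 x)]
      rfl
    obtain ⟨hm, heq⟩ := mean_eq_zero_of_periodicMap_eq_zero hQ hq h1
    -- The primitive differentiates to the field minus its mean, and the mean is zero.
    have h4 := hasDerivAt_primitive (superpos (fun _ => A) (ψ ε) + ε • superpos G (ψ ε)) t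
    rw [hm, sub_zero] at h4
    have h5 := h4.const_add (ψ ε 0)
    simp only [ContinuousMap.add_apply, ContinuousMap.smul_apply,
      superpos_apply (f := fun _ : AddCircle T => A) hA.continuousOn h3,
      superpos_apply hG.continuousOn h3] at h5
    have h6 : (fun t : ℝ => ψ ε t) = fun t : ℝ => ψ ε 0 +
        primitive (superpos (fun _ => A) (ψ ε) + ε • superpos G (ψ ε)) t := by
      funext s
      exact congrArg (fun u : C(AddCircle T, E) => u s) heq
    rw [h6]
    exact h5
  have hev : ContinuousOn (fun y : ℝ × ℝ => ((y.1 : AddCircle T), ψ y.2 y.1))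
      (univ ×ˢ Ioo (-δ) δ) := by
    have h3 : Continuous fun y : ℝ × ℝ => (y.1 : AddCircle T) :=
      (AddCircle.continuous_mk' T).comp continuous_fst
    have h4 : ContinuousOn (fun y : ℝ × ℝ => ψ y.2) (univ ×ˢ Ioo (-δ) δ) :=
      hψc.continuousOn.comp continuousOn_snd fun y hy => hy.2
    exact h3.continuousOn.prodMk
      (ContinuousEval.continuous_eval.comp_continuousOn (h4.prodMk h3.continuousOn))
  have hmaps : MapsTo (fun y : ℝ × ℝ => ((y.1 : AddCircle T), ψ y.2 y.1))
      (univ ×ˢ Ioo (-δ) δ) (univ ×ˢ Ω) := fun y hy => ⟨mem_univ _, (hball y.2 hy.2).2 _⟩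
  refine ⟨δ, hδ, fun t ε => ψ ε t, ?_, fun ε hε t => ⟨(hball ε hε).2 t, hderiv ε hε t, ?_⟩, ?_⟩
  · exact contDiffOn_uncurry (V := fun t ε => A (ψ ε t) + ε • G t (ψ ε t)) isOpen_Ioo hψc
      ((hA.continuousOn.comp hev hmaps).add
        (continuousOn_snd.smul (hG.continuousOn.comp hev hmaps))) hderiv
  · simp
  · intro t
    change ψ 0 t = w₀
    rw [hψ₀]
    rfl

end PeriodicFunction

/-! ### Regularity in the space variable, and descent of time-periodic functions to the circle -/

namespace Superposition

open Filter Topology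

variable {K E F : Type*} [TopologicalSpace K] [NormedAddCommGroup E] [NormedAddCommGroup F]
  [NormedSpace ℝ E] [NormedSpace ℝ F]

theorem IsC01On.of_contDiffOn {g : E → F} {s : Set E} (hs : IsOpen s) (hg : ContDiffOn ℝ 1 g s) :
    IsC01On (fun _ : K => g) s where
  differentiableAt _ _ hz := (hg.differentiableOn one_ne_zero).differentiableAt (hs.mem_nhds hz)
  continuousOn := hg.continuousOn.comp continuousOn_snd fun _ hy => hy.2
  continuousOn_fderiv :=
    (hg.continuousOn_fderiv_of_isOpen hs le_rfl).comp continuousOn_snd fun _ hy => hy.2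

theorem IsC01On.clm_comp {G : Type*} [NormedAddCommGroup G] [NormedSpace ℝ G] {f : K → E → F}
    {s : Set E} (hf : IsC01On f s) (S : F →L[ℝ] G) : IsC01On (fun x z => S (f x z)) s where
  differentiableAt x z hz := S.differentiableAt.comp z (hf.differentiableAt x z hz)
  continuousOn := S.continuous.comp_continuousOn hf.continuousOn
  continuousOn_fderiv := by
    have h : ContinuousOn (fun y : K × E => S.comp (fderiv ℝ (f y.1) y.2)) (univ ×ˢ s) :=
      continuousOn_const.clm_comp hf.continuousOn_fderiv
    exact h.congr fun y hy =>
      (S.hasFDerivAt.comp y.2 (hf.differentiableAt y.1 y.2 hy.2).hasFDerivAt).fderiv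

/-- `f(x, z)` is twice differentiable in `z ∈ s`, with derivatives continuous on `K × s`. -/
def IsC02On (f : K → E → F) (s : Set E) : Prop :=
  IsC01On f s ∧ IsC01On (fun x => fderiv ℝ (f x)) s

section Circle

variable {T : ℝ} {f : ℝ → E → F} {s : Set E}

/-- `Quotient.out` chooses an arbitrary representative of the time; periodicity makes the choice
irrelevant, but only for points of `s`. -/
theorem apply_out_coe {E F : Type*} {T : ℝ} {f : ℝ → E → F} {s : Set E}
    (hp : ∀ t, ∀ z ∈ s, f (t + T) z = f t z)
    (t : ℝ) {z : E} (hz : z ∈ s) : f (t : AddCircle T).out z = f t z := by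
  have hper : Function.Periodic (fun t => f t z) T := fun t => hp t z hz
  have h : (((t : AddCircle T).out : ℝ) : AddCircle T) = t := Quotient.out_eq _
  have h1 := hper.lift_coe (t : AddCircle T).out
  rw [h, hper.lift_coe] at h1
  exact h1.symm

omit [NormedSpace ℝ E] [NormedSpace ℝ F] in
-- The section `out` is not continuous. Instead, `ℝ × E → AddCircle T × E` is an open quotient map,
-- so neighbourhood filters downstairs are images of those upstairs.
theorem continuousOn_out (hs : IsOpen s)
    (hf : ContinuousOn (fun y : ℝ × E => f y.1 y.2) (univ ×ˢ s))
    (hp : ∀ t, ∀ z ∈ s, f (t + T) z = f t z) :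
    ContinuousOn (fun y : AddCircle T × E => f y.1.out y.2) (univ ×ˢ s) := by
  rintro ⟨x, z⟩ ⟨-, hz⟩
  apply ContinuousAt.continuousWithinAt
  induction x using QuotientAddGroup.induction_on with | _ t => ?_
  have hO : IsOpen ((univ : Set ℝ) ×ˢ s) := isOpen_univ.prod hs
  have hq : IsOpenQuotientMap (Prod.map ((↑) : ℝ → AddCircle T) (id : E → E)) :=
    QuotientAddGroup.isOpenQuotientMap_mk.prodMap IsOpenQuotientMap.id
  have hmap := hq.map_nhds_eq (t, z)
  have hmem : (t, z) ∈ (univ : Set ℝ) ×ˢ s := ⟨mem_univ _, hz⟩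
  rw [ContinuousAt]
  change Tendsto _ (𝓝 (Prod.map ((↑) : ℝ → AddCircle T) (id : E → E) (t, z))) _
  rw [← hmap, tendsto_map'_iff]
  have h1 : f (t : AddCircle T).out z = f t z := apply_out_coe hp t hz
  simp only
  rw [h1]
  refine (hf.continuousAt (hO.mem_nhds hmem)).tendsto.congr' ?_
  filter_upwards [hO.mem_nhds hmem] with y hy
  exact (apply_out_coe hp y.1 hy.2).symm

theorem fderiv_periodic (hs : IsOpen s) (hp : ∀ t, ∀ z ∈ s, f (t + T) z = f t z) :
    ∀ t, ∀ z ∈ s, fderiv ℝ (f (t + T)) z = fderiv ℝ (f t) z := fun t z hz =>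
  Filter.EventuallyEq.fderiv_eq (by filter_upwards [hs.mem_nhds hz] with y hy using hp t y hy)

theorem IsC01On.out (hs : IsOpen s) (hf : IsC01On f s) (hp : ∀ t, ∀ z ∈ s, f (t + T) z = f t z) :
    IsC01On (fun x : AddCircle T => f x.out) s where
  differentiableAt _ z hz := hf.differentiableAt _ z hz
  continuousOn := continuousOn_out hs hf.continuousOn hp
  continuousOn_fderiv := continuousOn_out (f := fun t => fderiv ℝ (f t)) hs
    hf.continuousOn_fderiv (fderiv_periodic hs hp)

theorem IsC02On.out (hs : IsOpen s) (hf : IsC02On f s) (hp : ∀ t, ∀ z ∈ s, f (t + T) z = f t z) :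
    IsC02On (fun x : AddCircle T => f x.out) s :=
  ⟨hf.1.out hs hp, hf.2.out hs (fderiv_periodic hs hp)⟩

end Circle

/-- Needed for the passage to the rotating angle, where `b t = (N t, 0)`. -/
theorem IsC01On.comp_add {f : ℝ → E → F} {s : Set E} (hf : IsC01On f s) {b : ℝ → E}
    (hb : Continuous b) (hbs : ∀ t, ∀ z ∈ s, z + b t ∈ s) :
    IsC01On (fun t z => f t (z + b t)) s := by
  have hm : ContinuousOn (fun y : ℝ × E => (y.1, y.2 + b y.1)) (univ ×ˢ s) := by fun_prop
  have hmaps : MapsTo (fun y : ℝ × E => (y.1, y.2 + b y.1)) (univ ×ˢ s) (univ ×ˢ s) :=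
    fun y hy => ⟨mem_univ _, hbs y.1 y.2 hy.2⟩
  refine ⟨fun t z hz => ?_, hf.continuousOn.comp hm hmaps, ?_⟩
  · exact (differentiableAt_comp_add_right (b t)).2 (hf.differentiableAt t _ (hbs t z hz))
  · simp only [fderiv_comp_add_right]
    exact hf.continuousOn_fderiv.comp hm hmaps

theorem IsC02On.comp_add {f : ℝ → E → F} {s : Set E} (hf : IsC02On f s) {b : ℝ → E}
    (hb : Continuous b) (hbs : ∀ t, ∀ z ∈ s, z + b t ∈ s) :
    IsC02On (fun t z => f t (z + b t)) s := by
  refine ⟨hf.1.comp_add hb hbs, ?_⟩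
  have h := hf.2.comp_add hb hbs
  have h1 : (fun t => fderiv ℝ fun z => f t (z + b t)) = fun t z => fderiv ℝ (f t) (z + b t) := by
    funext t z
    exact fderiv_comp_add_right (b t)
  rwa [h1]

end Superposition

namespace PeriodicFunction

open Filter Topology Superposition

variable {T : ℝ} [hT : Fact (0 < T)] {E F : Type*} [NormedAddCommGroup E] [NormedSpace ℝ E]
  [NormedAddCommGroup F] [NormedSpace ℝ F] [CompleteSpace F]

/-- Differentiation of a mean value with respect to a parameter. -/
theorem hasFDerivAt_mean_superpos {f : AddCircle T → E → F} {s : Set E} (hs : IsOpen s)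
    (hf : IsC01On f s) {z : E} (hz : z ∈ s) :
    HasFDerivAt (fun z => mean (superpos f (constL z)))
      (mean (superpos (fun x => fderiv ℝ (f x)) (constL z))) z := by
  have h1 := hf.hasFDerivAt_superpos hs (w := constL z) fun _ => hz
  have h2 : HasFDerivAt (fun z => superpos f (constL z))
      ((pointwiseApply (superpos (fun x => fderiv ℝ (f x)) (constL z))).comp
        (constL (T := T) (E := E))) z := h1.comp z (constL (T := T) (E := E)).hasFDerivAt
  have h3 : HasFDerivAt (fun z => mean (superpos f (constL z)))
      ((mean (T := T) (E := F)).comp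
        ((pointwiseApply (superpos (fun x => fderiv ℝ (f x)) (constL z))).comp
        (constL (T := T) (E := E)))) z := (mean (T := T) (E := F)).hasFDerivAt.comp z h2
  refine h3.congr_fderiv ?_
  ext v
  exact mean_comp (ContinuousLinearMap.apply ℝ F v)
    (superpos (fun x => fderiv ℝ (f x)) (constL z)) _ fun _ => rfl

end PeriodicFunction

/-! ### Averaging and the degenerate Hamiltonian system -/

namespace DegenerateHamiltonian

open Filter Topology Superposition PeriodicFunction

theorem IsNondegenerateCriticalPoint.eq_zero_of_forall {F : Type*} [NormedAddCommGroup F]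
    [NormedSpace ℝ F] [FiniteDimensional ℝ F] {f : F → ℝ} {a : F}
    (h : IsNondegenerateCriticalPoint f a) {v : F}
    (hv : ∀ w, fderiv ℝ (fderiv ℝ f) a v w = 0) : v = 0 :=
  (LinearMap.BilinForm.nondegenerate_iff_det_ne_zero _).2 h.2 |>.1 v hv

section Averaging

variable {T : ℝ} [hT : Fact (0 < T)] {E X : Type*} [NormedAddCommGroup E] [NormedSpace ℝ E]
  [NormedAddCommGroup X] [NormedSpace ℝ X]

theorem hasFDerivAt_mean_superpos_comp {f : AddCircle T → E → ℝ} {Ω : Set E} (hΩ : IsOpen Ω)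
    (hf : IsC01On f Ω) {e : X → E} {ι : X →L[ℝ] E} {w : X} (he : HasFDerivAt e ι w)
    (hw : e w ∈ Ω) :
    HasFDerivAt (fun w => mean (superpos f (constL (e w))))
      ((mean (superpos (fun x => fderiv ℝ (f x)) (constL (e w)))).comp ι) w :=
  (hasFDerivAt_mean_superpos hΩ hf hw).comp w he

/-- Differentiation passes under the mean twice; as `e` has constant derivative `ι`, no second-order
term of `e` appears. -/
theorem fderiv_fderiv_mean_superpos_comp {f : AddCircle T → E → ℝ} {Ω : Set E} (hΩ : IsOpen Ω)
    (hf : IsC02On f Ω) {e : X → E} {ι : X →L[ℝ] E} (he : ∀ w, HasFDerivAt e ι w)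
    {w : X} (hw : e w ∈ Ω) (v u : X) :
    fderiv ℝ (fderiv ℝ fun w => mean (superpos f (constL (e w)))) w v u =
      mean (superpos (fun x => fderiv ℝ (fderiv ℝ (f x))) (constL (e w))) (ι v) (ι u) := by
  have hO : ∀ᶠ w in 𝓝 w, e w ∈ Ω := (he w).continuousAt (hΩ.mem_nhds hw)
  have h1 : HasFDerivAt (fun w => mean (superpos (fun x => fderiv ℝ (f x)) (constL (e w))))
      ((mean (superpos (fun x => fderiv ℝ (fderiv ℝ (f x))) (constL (e w)))).comp ι) w :=
    (hasFDerivAt_mean_superpos hΩ hf.2 hw).comp w (he w)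
  have h2 := h1.clm_comp (hasFDerivAt_const ι w)
  have h3 := h2.congr_of_eventuallyEq
    (f₁ := fderiv ℝ (fun w => mean (superpos f (constL (e w)))))
    (by filter_upwards [hO] with w hw using
          (hasFDerivAt_mean_superpos_comp hΩ hf.1 (he w) hw).fderiv)
  rw [h3.fderiv]
  simp

/-- Periodic solutions of `w' = A(w) + ε S ∂f(t, w)`, near a nondegenerate critical point of the
average of `f`. -/
theorem exists_periodic_family_of_averaged [FiniteDimensional ℝ E] [FiniteDimensional ℝ X]
    {Ω : Set E} (hΩ : IsOpen Ω)
    {A : E → E} {f : AddCircle T → E → ℝ} {Q : E →L[ℝ] E} {S : (E →L[ℝ] ℝ) →L[ℝ] E}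
    (hA : IsC01On (fun _ : AddCircle T => A) Ω) (hf : IsC02On f Ω)
    (hQ : ∀ c, Q (Q c) = Q c) (hQA : ∀ z ∈ Ω, Q (A z) = 0)
    {e : X → E} {ι : X →L[ℝ] E} (he : ∀ w, HasFDerivAt e ι w) {x₀ : X} (hx₀ : e x₀ ∈ Ω)
    (hA₀ : A (e x₀) = 0) (hR : (fderiv ℝ A (e x₀)).comp (fderiv ℝ A (e x₀)) = 0)
    (hQS : ∀ ℓ, Q (S ℓ) = 0 ↔ ℓ.comp ι = 0)
    (hker : ∀ c d, fderiv ℝ A (e x₀) c + Q d = 0 → Q d = 0 ∧ ∃ v, c = ι v)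
    {g : X → ℝ} (hg : g =ᶠ[𝓝 x₀] fun w => mean (superpos f (constL (e w))))
    (hcrit : IsNondegenerateCriticalPoint g x₀) :
    ∃ δ : ℝ, 0 < δ ∧ ∃ W : ℝ → ℝ → E,
      ContDiffOn ℝ 1 (fun y : ℝ × ℝ => W y.1 y.2) (univ ×ˢ Ioo (-δ) δ) ∧
      (∀ ε ∈ Ioo (-δ) δ, ∀ t, W t ε ∈ Ω ∧
        HasDerivAt (fun t => W t ε) (A (W t ε) + ε • S (fderiv ℝ (f t) (W t ε))) t ∧
        W (t + T) ε = W t ε) ∧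
      ∀ t, W t 0 = e x₀ := by
  have hG : IsC01On (fun x z => S (fderiv ℝ (f x) z)) Ω := hf.2.clm_comp S
  have hS1 : mean (superpos (fun x z => S (fderiv ℝ (f x) z)) (constL (e x₀))) =
      S (mean (superpos (fun x => fderiv ℝ (f x)) (constL (e x₀)))) := by
    have hcomp : CompleteSpace E := FiniteDimensional.complete ℝ E
    refine mean_comp S _ _ fun x => ?_
    rw [superpos_apply hG.continuousOn fun _ => hx₀,
      superpos_apply (f := fun x => fderiv ℝ (f x)) hf.1.continuousOn_fderiv fun _ => hx₀]
  have hS2 : ∀ c, mean (superpos (fun x => fderiv ℝ fun z => S (fderiv ℝ (f x) z))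
      (constL (e x₀))) c =
      S (mean (superpos (fun x => fderiv ℝ (fderiv ℝ (f x))) (constL (e x₀))) c) := fun c => by
    have hcomp : CompleteSpace E := FiniteDimensional.complete ℝ E
    have h1 := mean_comp (ContinuousLinearMap.postcomp E S)
      (superpos (fun x => fderiv ℝ (fderiv ℝ (f x))) (constL (e x₀)))
      (superpos (fun x => fderiv ℝ fun z => S (fderiv ℝ (f x) z)) (constL (e x₀))) fun x => by
        rw [superpos_apply (f := fun x => fderiv ℝ fun z => S (fderiv ℝ (f x) z))
            hG.continuousOn_fderiv fun _ => hx₀,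
          superpos_apply (f := fun x => fderiv ℝ (fderiv ℝ (f x)))
            hf.2.continuousOn_fderiv fun _ => hx₀]
        exact (S.hasFDerivAt.comp _ (hf.2.differentiableAt x (e x₀) hx₀).hasFDerivAt).fderiv
    rw [h1]
    rfl
  refine exists_periodic_family hΩ hA hG hQ hQA hx₀ hA₀ hR ?_ fun c hc => ?_
  · rw [hS1, hQS]
    exact ((hasFDerivAt_mean_superpos_comp hΩ hf.1 (he x₀) hx₀).congr_of_eventuallyEq hg).unique
      hcrit.1
  -- By `hker` and `hQS`, a kernel vector is `ι v` with `v` in the kernel of the Hessian of the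
  -- average.
  · rw [hS2] at hc
    obtain ⟨hd, v, rfl⟩ := hker _ _ hc
    rw [hQS] at hd
    rw [hcrit.eq_zero_of_forall (v := v) fun u => ?_, map_zero]
    rw [hg.fderiv.fderiv_eq, fderiv_fderiv_mean_superpos_comp hΩ hf he hx₀]
    exact congrArg (fun A => A u) hd

end Averaging

instance fact_two_pi_pos : Fact (0 < 2 * Real.pi) := ⟨Real.two_pi_pos⟩

variable {V : Type*} [NormedAddCommGroup V] [InnerProductSpace ℝ V] [FiniteDimensional ℝ V]

/-- The Hamiltonian vector field `(-∂_r, -∂_p, ∂_θ, ∂_q)`, as a function of the differential. -/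
noncomputable def hamiltonianField : ((ℝ × V × ℝ × V) →L[ℝ] ℝ) →L[ℝ] (ℝ × V × ℝ × V) :=
  have : CompleteSpace V := FiniteDimensional.complete ℝ V
  LinearMap.toContinuousLinearMap
    { toFun := fun ℓ => (-ℓ (0, 0, 1, 0),
        -(InnerProductSpace.toDual ℝ V).symm
          (ℓ.comp ((ContinuousLinearMap.inr ℝ ℝ (V × ℝ × V)).comp
            ((ContinuousLinearMap.inr ℝ V (ℝ × V)).comp (ContinuousLinearMap.inr ℝ ℝ V)))),
        ℓ (1, 0, 0, 0),
        (InnerProductSpace.toDual ℝ V).symm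
          (ℓ.comp ((ContinuousLinearMap.inr ℝ ℝ (V × ℝ × V)).comp
            (ContinuousLinearMap.inl ℝ V (ℝ × V)))))
      map_add' := fun a b => by
        simp [ContinuousLinearMap.add_comp, add_comm]
      map_smul' := fun c a => by
        simp [ContinuousLinearMap.smul_comp] }

/-- The inclusion of the `(θ, q, p)`-space into the phase space. -/
noncomputable def slowInclusion : (ℝ × V × V) →L[ℝ] (ℝ × V × ℝ × V) :=
  (ContinuousLinearMap.fst ℝ ℝ (V × V)).prod
    (((ContinuousLinearMap.fst ℝ V V).comp (ContinuousLinearMap.snd ℝ ℝ (V × V))).prod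
      ((0 : (ℝ × V × V) →L[ℝ] ℝ).prod
        ((ContinuousLinearMap.snd ℝ V V).comp (ContinuousLinearMap.snd ℝ ℝ (V × V)))))

omit [FiniteDimensional ℝ V] in
@[simp]
theorem slowInclusion_apply (w : ℝ × V × V) : slowInclusion w = (w.1, w.2.1, 0, w.2.2) := rfl

/-- The projection forgetting the component `θ`. -/
noncomputable def slowProjection : (ℝ × V × ℝ × V) →L[ℝ] (ℝ × V × ℝ × V) :=
  (ContinuousLinearMap.inr ℝ ℝ (V × ℝ × V)).comp (ContinuousLinearMap.snd ℝ ℝ (V × ℝ × V))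

omit [FiniteDimensional ℝ V] in
@[simp]
theorem slowProjection_apply (z : ℝ × V × ℝ × V) : slowProjection z = (0, z.2) := rfl

/-- The `r`-derivative enters the Hamiltonian field only through its `θ`-component, which is the one
forgotten; what is left is the differential along `(θ, q, p)`. -/
theorem slowProjection_hamiltonianField_eq_zero_iff (ℓ : (ℝ × V × ℝ × V) →L[ℝ] ℝ) :
    slowProjection (hamiltonianField ℓ) = 0 ↔ ℓ.comp slowInclusion = 0 := by
  have hcomp : CompleteSpace V := FiniteDimensional.complete ℝ V
  have hval : slowProjection (hamiltonianField ℓ) = (0,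
        -(InnerProductSpace.toDual ℝ V).symm
          (ℓ.comp ((ContinuousLinearMap.inr ℝ ℝ (V × ℝ × V)).comp
            ((ContinuousLinearMap.inr ℝ V (ℝ × V)).comp (ContinuousLinearMap.inr ℝ ℝ V)))),
        ℓ (1, 0, 0, 0),
        (InnerProductSpace.toDual ℝ V).symm
          (ℓ.comp ((ContinuousLinearMap.inr ℝ ℝ (V × ℝ × V)).comp
            (ContinuousLinearMap.inl ℝ V (ℝ × V))))) := rfl
  rw [hval]
  simp only [Prod.mk_eq_zero, neg_eq_zero, true_and,
    EmbeddingLike.map_eq_zero_iff]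
  constructor
  · rintro ⟨hp, hθ, hq⟩
    ext w
    · simpa using hθ
    · simpa [Prod.mk_zero_zero] using congrArg (fun A => A w) hq
    · simpa using congrArg (fun A => A w) hp
  · intro h
    refine ⟨?_, ?_, ?_⟩
    · ext p
      simpa using congrArg (fun A => A (0, 0, p)) h
    · simpa using congrArg (fun A => A (1, 0, 0)) h
    · ext q
      simpa [Prod.mk_zero_zero] using congrArg (fun A => A (0, q, 0)) h

/-- Existence of periodic solutions for `h(r) - ε 𝒰`, in terms of the differential of `𝒰`. -/
theorem exists_periodic_family_fderiv {I : Set ℝ} {Ω : Set (ℝ × V × ℝ × V)} {h : ℝ → ℝ}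
    {𝒰 : ℝ → ℝ × V × ℝ × V → ℝ} (hI : IsOpen I) (hΩ : IsOpen Ω) (hΩI : ∀ z ∈ Ω, z.2.2.1 ∈ I)
    (hΩθ : ∀ z ∈ Ω, ∀ s, (s, z.2) ∈ Ω) (hh : ContDiffOn ℝ 2 h I) (hU : IsC02On 𝒰 Ω)
    (hUt : ∀ t, ∀ z ∈ Ω, 𝒰 (t + 2 * Real.pi) z = 𝒰 t z)
    (hUθ : ∀ t, ∀ z ∈ Ω, 𝒰 t (z.1 + 2 * Real.pi, z.2) = 𝒰 t z)
    (N : ℤ) {rN : ℝ} (hrN : deriv h rN = N) (hrN' : deriv (deriv h) rN ≠ 0)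
    {θ₀ : ℝ} {q₀ p₀ : V} (h₀ : (θ₀, q₀, rN, p₀) ∈ Ω)
    (hcrit : IsNondegenerateCriticalPoint (fun w : ℝ × V × V => 1 / (2 * Real.pi) *
      ∫ t in (0 : ℝ)..(2 * Real.pi), 𝒰 t (w.1 + N * t, w.2.1, rN, w.2.2)) (θ₀, q₀, p₀)) :
    ∃ δ : ℝ, 0 < δ ∧ ∃ W : ℝ → ℝ → ℝ × V × ℝ × V,
      ContDiffOn ℝ 1 (fun y : ℝ × ℝ => W y.1 y.2) (univ ×ˢ Ioo (-δ) δ) ∧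
      (∀ ε ∈ Ioo (-δ) δ, ∀ t, W t ε ∈ Ω ∧
        HasDerivAt (fun t => W t ε) ((deriv h (W t ε).2.2.1, 0) +
          ε • hamiltonianField (fderiv ℝ (𝒰 t) (W t ε))) t ∧
        W (t + 2 * Real.pi) ε = ((W t ε).1 + 2 * Real.pi * N, (W t ε).2)) ∧
      ∀ t, W t 0 = (θ₀ + N * t, q₀, rN, p₀) := by
  have hcomp : CompleteSpace V := FiniteDimensional.complete ℝ V
  have hrI : rN ∈ I := hΩI _ h₀
  let b : ℝ → ℝ × V × ℝ × V := fun t => (N * t, 0)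
  have hb : Continuous b := by fun_prop
  have hbΩ : ∀ t, ∀ z ∈ Ω, z + b t ∈ Ω := fun t z hz => by
    have := hΩθ z hz (z.1 + N * t)
    simpa [b, Prod.add_def] using this
  let f : ℝ → ℝ × V × ℝ × V → ℝ := fun t z => 𝒰 t (z + b t)
  have hf : IsC02On f Ω := hU.comp_add hb hbΩ
  have hUθn : ∀ n : ℤ, ∀ t, ∀ z ∈ Ω, 𝒰 t (z.1 + n * (2 * Real.pi), z.2) = 𝒰 t z := by
    intro n t z hz
    have hper : Function.Periodic (fun s => 𝒰 t (s, z.2)) (2 * Real.pi) :=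
      fun s => hUθ t (s, z.2) (hΩθ z hz s)
    exact hper.int_mul n z.1
  -- Over one period the frame turns by `2π N`, which periodicity in `θ` absorbs because `N` is an
  -- integer.
  have hfp : ∀ t, ∀ z ∈ Ω, f (t + 2 * Real.pi) z = f t z := fun t z hz => by
    simp only [f]
    rw [hUt _ _ (hbΩ _ z hz), ← hUθn N t _ (hbΩ t z hz)]
    congr 1
    ext <;> simp [b]
    ring
  have hv : IsC02On (fun x : AddCircle (2 * Real.pi) => f x.out) Ω := hf.out hΩ hfp
  have hdf : ∀ t z, fderiv ℝ (f t) z = fderiv ℝ (𝒰 t) (z + b t) := fun t z =>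
    fderiv_comp_add_right (b t)
  let A : ℝ × V × ℝ × V → ℝ × V × ℝ × V := fun z => (deriv h z.2.2.1 - N, 0)
  have hdh : ContDiffOn ℝ 1 (deriv h) I := hh.deriv_of_isOpen hI le_rfl
  have hA' : ContDiffOn ℝ 1 A Ω := by
    have h1 : ContDiffOn ℝ 1 (fun z : ℝ × V × ℝ × V => deriv h z.2.2.1) Ω :=
      hdh.comp (by fun_prop) hΩI
    exact (h1.sub contDiffOn_const).prodMk contDiffOn_const
  have hA : IsC01On (fun _ : AddCircle (2 * Real.pi) => A) Ω := IsC01On.of_contDiffOn hΩ hA'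
  set w₀ : ℝ × V × ℝ × V := (θ₀, q₀, rN, p₀) with hw₀
  have hdA : ∀ c, fderiv ℝ A w₀ c = (deriv (deriv h) rN * c.2.2.1, 0) := by
    have h1 : HasDerivAt (deriv h) (deriv (deriv h) rN) w₀.2.2.1 :=
      ((hdh.differentiableOn one_ne_zero).differentiableAt (hI.mem_nhds hrI)).hasDerivAt
    have h2 : HasFDerivAt (fun z : ℝ × V × ℝ × V => z.2.2.1)
        ((ContinuousLinearMap.fst ℝ ℝ V).comp ((ContinuousLinearMap.snd ℝ V (ℝ × V)).comp
          (ContinuousLinearMap.snd ℝ ℝ (V × ℝ × V)))) w₀ :=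
      ((ContinuousLinearMap.fst ℝ ℝ V).comp ((ContinuousLinearMap.snd ℝ V (ℝ × V)).comp
          (ContinuousLinearMap.snd ℝ ℝ (V × ℝ × V)))).hasFDerivAt
    have h3 := HasDerivAt.comp_hasFDerivAt (h₂ := deriv h)
      (f := fun z : ℝ × V × ℝ × V => z.2.2.1) w₀ h1 h2
    have h4 := (h3.sub_const (N : ℝ)).prodMk (hasFDerivAt_const (0 : V × ℝ × V) w₀)
    have h5 : HasFDerivAt A _ w₀ := h4
    intro c
    rw [h5.fderiv]
    simp
  let e : ℝ × V × V → ℝ × V × ℝ × V := fun w => (w.1, w.2.1, rN, w.2.2)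
  have hΩ' : IsOpen {w | e w ∈ Ω} := hΩ.preimage (by fun_prop)
  have he : ∀ w, HasFDerivAt e slowInclusion w := fun w => by
    have h1 : e = fun w => slowInclusion w + (0, 0, rN, 0) := by
      funext w; simp [e]
    rw [h1]
    exact (slowInclusion (V := V)).hasFDerivAt.add_const _
  -- Restricted to `e w ∈ Ω`, since elsewhere `superpos` may take its default value; equality near
  -- the critical point suffices.
  have hav : ∀ w, e w ∈ Ω → 1 / (2 * Real.pi) * ∫ t in (0 : ℝ)..(2 * Real.pi),
      𝒰 t (w.1 + N * t, w.2.1, rN, w.2.2) =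
      mean (superpos (fun x : AddCircle (2 * Real.pi) => f x.out) (constL (e w))) := by
    intro w hw
    rw [mean_apply, one_div, smul_eq_mul]
    congr 1
    refine intervalIntegral.integral_congr fun t _ => ?_
    rw [superpos_apply hv.1.continuousOn fun _ => hw, constL_apply, apply_out_coe hfp t hw]
    simp [f, b, e]
  obtain ⟨δ, hδ, W, hW1, hW2, hW3⟩ := exists_periodic_family_of_averaged
    (Q := slowProjection) (S := hamiltonianField) hΩ hA hv (fun c => rfl)
    (fun z _ => by simp [A]) he (x₀ := (θ₀, q₀, p₀)) h₀ (by simp [A, hrN, e])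
    (by
      refine ContinuousLinearMap.ext fun c => ?_
      rw [ContinuousLinearMap.comp_apply, hdA, hdA]
      simp)
    slowProjection_hamiltonianField_eq_zero_iff
    (by
      intro c d hc
      rw [hdA] at hc
      -- The `θ`-component of the equation is `h''(r_N) c_r = 0`, as `slowProjection` contributes
      -- nothing there.
      have hc1 : c.2.2.1 = 0 := by
        have := congrArg Prod.fst hc
        simpa [hrN'] using this
      refine ⟨?_, (c.1, c.2.1, c.2.2.2), ?_⟩
      · rwa [hc1, mul_zero, Prod.mk_zero_zero, zero_add] at hc
      · rw [slowInclusion_apply, ← hc1])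
    (by filter_upwards [hΩ'.mem_nhds h₀] with w hw using hav w hw) hcrit
  -- Adding `b t` returns from the rotating angle to the original one.
  refine ⟨δ, hδ, fun t ε => W t ε + b t, ?_, fun ε hε t => ?_, fun t => ?_⟩
  · have hb' : ContDiff ℝ 1 fun y : ℝ × ℝ => b y.1 :=
      (contDiff_const.mul contDiff_fst).prodMk contDiff_const
    exact hW1.add hb'.contDiffOn
  · obtain ⟨h1, h2, h3⟩ := hW2 ε hε t
    refine ⟨hbΩ t _ h1, ?_, ?_⟩
    · have h4 : HasDerivAt b ((N : ℝ), 0) t := by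
        have := (((hasDerivAt_id t).const_mul (N : ℝ))).prodMk (hasDerivAt_const t (0 : V × ℝ × V))
        simpa using this
      refine (h2.add h4).congr_deriv ?_
      have h5 : fderiv ℝ (f (t : AddCircle (2 * Real.pi)).out) (W t ε) =
          fderiv ℝ (𝒰 t) (W t ε + b t) := by
        rw [apply_out_coe (f := fun t => fderiv ℝ (f t)) (fderiv_periodic hΩ hfp) t h1, hdf]
      rw [h5, add_right_comm]
      congr 1
      simp [A, b]
    · simp only
      rw [h3]
      ext <;> simp [b]
      ring
  · simp only
    rw [hW3]
    ext <;> simp [b, e]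

end DegenerateHamiltonian

/-! ### Second-order chain rule with a time parameter -/

namespace Superposition

variable {K E F : Type*} [TopologicalSpace K] [NormedAddCommGroup E] [NormedAddCommGroup F]
  [NormedSpace ℝ E] [NormedSpace ℝ F]

theorem IsC02On.comp_contDiffOn {G : Type*} [NormedAddCommGroup G] [NormedSpace ℝ G]
    {f : K → F → G} {u : Set F} (hf : IsC02On f u) {s : Set E} (hs : IsOpen s) {g : E → F}
    (hg : ContDiffOn ℝ 2 g s) (hgu : ∀ z ∈ s, g z ∈ u) : IsC02On (fun x z => f x (g z)) s := by
  have hm : ContinuousOn (fun y : K × E => (y.1, g y.2)) (univ ×ˢ s) :=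
    continuousOn_fst.prodMk (hg.continuousOn.comp continuousOn_snd fun _ hy => hy.2)
  have hmaps : MapsTo (fun y : K × E => (y.1, g y.2)) (univ ×ˢ s) (univ ×ˢ u) :=
    fun y hy => ⟨mem_univ _, hgu y.2 hy.2⟩
  have hg1 : ContDiffOn ℝ 1 (fderiv ℝ g) s := hg.fderiv_of_isOpen hs le_rfl
  have hd : ∀ z ∈ s, HasFDerivAt g (fderiv ℝ g z) z := fun z hz =>
    ((hg.differentiableOn two_ne_zero).differentiableAt (hs.mem_nhds hz)).hasFDerivAt
  have hdd : ∀ z ∈ s, HasFDerivAt (fderiv ℝ g) (fderiv ℝ (fderiv ℝ g) z) z := fun z hz =>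
    ((hg1.differentiableOn one_ne_zero).differentiableAt (hs.mem_nhds hz)).hasFDerivAt
  have h1 : ∀ x, ∀ z ∈ s, HasFDerivAt (fun z => f x (g z))
      ((fderiv ℝ (f x) (g z)).comp (fderiv ℝ g z)) z := fun x z hz =>
    (hf.1.differentiableAt x _ (hgu z hz)).hasFDerivAt.comp z (hd z hz)
  have h1e : ∀ x, ∀ z ∈ s, fderiv ℝ (fun z => f x (g z)) z =
      (fderiv ℝ (f x) (g z)).comp (fderiv ℝ g z) := fun x z hz => (h1 x z hz).fderiv
  have hcD : ContinuousOn (fun y : K × E => fderiv ℝ (f y.1) (g y.2)) (univ ×ˢ s) :=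
    hf.1.continuousOn_fderiv.comp hm hmaps
  have hcg : ContinuousOn (fun y : K × E => fderiv ℝ g y.2) (univ ×ˢ s) :=
    hg1.continuousOn.comp continuousOn_snd fun _ hy => hy.2
  have hcgg : ContinuousOn (fun y : K × E => fderiv ℝ (fderiv ℝ g) y.2) (univ ×ˢ s) :=
    (hg1.continuousOn_fderiv_of_isOpen hs le_rfl).comp continuousOn_snd fun _ hy => hy.2
  have hcDD : ContinuousOn (fun y : K × E => fderiv ℝ (fderiv ℝ (f y.1)) (g y.2)) (univ ×ˢ s) :=
    hf.2.continuousOn_fderiv.comp hm hmaps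
  have h2 : ∀ x, ∀ z ∈ s, HasFDerivAt (fderiv ℝ fun z => f x (g z))
      ((ContinuousLinearMap.compL ℝ E F G (fderiv ℝ (f x) (g z))).comp
          (fderiv ℝ (fderiv ℝ g) z) +
        ((ContinuousLinearMap.compL ℝ E F G).flip (fderiv ℝ g z)).comp
          ((fderiv ℝ (fderiv ℝ (f x)) (g z)).comp (fderiv ℝ g z))) z := fun x z hz => by
    have h3 : HasFDerivAt (fun z => fderiv ℝ (f x) (g z))
        ((fderiv ℝ (fderiv ℝ (f x)) (g z)).comp (fderiv ℝ g z)) z :=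
      (hf.2.differentiableAt x _ (hgu z hz)).hasFDerivAt.comp z (hd z hz)
    refine (h3.clm_comp (hdd z hz)).congr_of_eventuallyEq ?_
    filter_upwards [hs.mem_nhds hz] with y hy using h1e x y hy
  refine ⟨⟨fun x z hz => (h1 x z hz).differentiableAt, hf.1.continuousOn.comp hm hmaps,
    (hcD.clm_comp hcg).congr fun y hy => h1e y.1 y.2 hy.2⟩,
    fun x z hz => (h2 x z hz).differentiableAt,
    (hcD.clm_comp hcg).congr fun y hy => h1e y.1 y.2 hy.2, ?_⟩
  refine ContinuousOn.congr ?_ fun y hy => (h2 y.1 y.2 hy.2).fderiv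
  exact (((ContinuousLinearMap.compL ℝ E F G).continuous.comp_continuousOn hcD).clm_comp hcgg).add
    (((ContinuousLinearMap.compL ℝ E F G).flip.continuous.comp_continuousOn hcg).clm_comp
      (hcDD.clm_comp hcg))

end Superposition

/-! ### From iterated derivatives to nested ones, and from the differential to partial derivatives
-/

namespace DegenerateHamiltonian

open Filter Topology Superposition PeriodicFunction

theorem IsC03On.isC02On {F : Type*} [NormedAddCommGroup F] [NormedSpace ℝ F] {f : ℝ → F → ℝ}
    {s : Set F} (hs : IsOpen s) (hf : IsC03On f s) : IsC02On f s := by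
  obtain ⟨hd, hc⟩ := hf
  have h0 : ContinuousOn (fun y : ℝ × F => f y.1 y.2) (univ ×ˢ s) := by
    have h := (continuousMultilinearCurryFin0 ℝ F ℝ).continuous.comp_continuousOn
      (hc 0 (by norm_num))
    refine h.congr fun y _ => ?_
    simp
  have h1 : ContinuousOn (fun y : ℝ × F => fderiv ℝ (f y.1) y.2) (univ ×ˢ s) := by
    have h := (continuousMultilinearCurryFin1 ℝ F ℝ).continuous.comp_continuousOn
      (hc 1 (by norm_num))
    refine h.congr fun y _ => ?_
    ext v
    simp [iteratedFDeriv_one_apply]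
  have h2 : ContinuousOn (fun y : ℝ × F => fderiv ℝ (fderiv ℝ (f y.1)) y.2) (univ ×ˢ s) := by
    let L : (F [×1]→L[ℝ] ℝ) →L[ℝ] (F →L[ℝ] ℝ) :=
      ((continuousMultilinearCurryFin1 ℝ F ℝ).toContinuousLinearEquiv :
        (F [×1]→L[ℝ] ℝ) →L[ℝ] (F →L[ℝ] ℝ))
    have h := (continuousMultilinearCurryLeftEquiv ℝ (fun _ : Fin 2 => F) ℝ).continuous.comp_continuousOn
      (hc 2 (by norm_num))
    have h' := (continuousOn_const (c := L)).clm_comp h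
    refine h'.congr fun y _ => ?_
    ext v w
    have := iteratedFDeriv_two_apply (𝕜 := ℝ) (f y.1) y.2 ![v, w]
    simp only [Matrix.cons_val_zero, Matrix.cons_val_one] at this
    rw [← this]
    -- `Fin.snoc 0 w` is the one-entry vector produced by uncurrying a linear map of one variable.
    change _ = iteratedFDeriv ℝ 2 (f y.1) y.2 (Fin.cons v (Fin.snoc 0 w))
    congr 1
    ext i
    fin_cases i <;> rfl
  have hd1 : ∀ t, ContDiffOn ℝ 2 (fderiv ℝ (f t)) s := fun t =>
    (hd t).fderiv_of_isOpen hs (by norm_num)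
  exact ⟨⟨fun t z hz => ((hd t).differentiableOn three_ne_zero).differentiableAt (hs.mem_nhds hz),
    h0, h1⟩, fun t z hz =>
      ((hd1 t).differentiableOn two_ne_zero).differentiableAt (hs.mem_nhds hz), h1, h2⟩

variable {V : Type*} [NormedAddCommGroup V] [InnerProductSpace ℝ V] [FiniteDimensional ℝ V]

theorem hamiltonianField_fderiv [CompleteSpace V] {u : ℝ × V × ℝ × V → ℝ} {z : ℝ × V × ℝ × V}
    (hu : DifferentiableAt ℝ u z) :
    hamiltonianField (fderiv ℝ u z) =
      (-deriv (fun s => u (z.1, z.2.1, s, z.2.2.2)) z.2.2.1,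
        -gradient (fun s => u (z.1, z.2.1, z.2.2.1, s)) z.2.2.2,
        deriv (fun s => u (s, z.2.1, z.2.2.1, z.2.2.2)) z.1,
        gradient (fun s => u (z.1, s, z.2.2.1, z.2.2.2)) z.2.1) := by
  obtain ⟨θ, q, r, p⟩ := z
  have hr : HasDerivAt (fun s => u (θ, q, s, p)) (fderiv ℝ u (θ, q, r, p) (0, 0, 1, 0)) r := by
    have h : HasDerivAt (fun s : ℝ => (θ, q, s, p)) (0, 0, 1, 0) r :=
      (hasDerivAt_const r θ).prodMk ((hasDerivAt_const r q).prodMk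
        ((hasDerivAt_id r).prodMk (hasDerivAt_const r p)))
    exact HasFDerivAt.comp_hasDerivAt r (f := fun s : ℝ => (θ, q, s, p)) hu.hasFDerivAt h
  have hθ : HasDerivAt (fun s => u (s, q, r, p)) (fderiv ℝ u (θ, q, r, p) (1, 0, 0, 0)) θ := by
    have h : HasDerivAt (fun s : ℝ => (s, q, r, p)) (1, 0, 0, 0) θ :=
      (hasDerivAt_id θ).prodMk (hasDerivAt_const θ (q, r, p))
    exact HasFDerivAt.comp_hasDerivAt θ (f := fun s : ℝ => (s, q, r, p)) hu.hasFDerivAt h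
  have hp : HasFDerivAt (fun s => u (θ, q, r, s)) ((fderiv ℝ u (θ, q, r, p)).comp
      ((ContinuousLinearMap.inr ℝ ℝ (V × ℝ × V)).comp
        ((ContinuousLinearMap.inr ℝ V (ℝ × V)).comp (ContinuousLinearMap.inr ℝ ℝ V)))) p := by
    have h : HasFDerivAt (fun s : V => (θ, q, r, s))
        ((ContinuousLinearMap.inr ℝ ℝ (V × ℝ × V)).comp
        ((ContinuousLinearMap.inr ℝ V (ℝ × V)).comp (ContinuousLinearMap.inr ℝ ℝ V))) p :=
      (hasFDerivAt_prodMk_right θ (q, r, p)).comp p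
        ((hasFDerivAt_prodMk_right q (r, p)).comp p (hasFDerivAt_prodMk_right r p))
    exact HasFDerivAt.comp p (f := fun s : V => (θ, q, r, s)) hu.hasFDerivAt h
  have hq : HasFDerivAt (fun s => u (θ, s, r, p)) ((fderiv ℝ u (θ, q, r, p)).comp
      ((ContinuousLinearMap.inr ℝ ℝ (V × ℝ × V)).comp
        (ContinuousLinearMap.inl ℝ V (ℝ × V)))) q := by
    have h : HasFDerivAt (fun s : V => (θ, s, r, p))
        ((ContinuousLinearMap.inr ℝ ℝ (V × ℝ × V)).comp
        (ContinuousLinearMap.inl ℝ V (ℝ × V))) q :=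
      (hasFDerivAt_prodMk_right θ (q, r, p)).comp q (hasFDerivAt_prodMk_left q (r, p))
    exact HasFDerivAt.comp q (f := fun s : V => (θ, s, r, p)) hu.hasFDerivAt h
  simp only [gradient, hr.deriv, hθ.deriv, hp.fderiv, hq.fderiv]
  rfl

/-- Existence of periodic solutions for `h(r) - ε 𝒰` with `𝒰` of class `C^{0,2}`. -/
theorem exists_periodic_solutions [CompleteSpace V] {I : Set ℝ} {Ω : Set (ℝ × V × ℝ × V)}
    {h : ℝ → ℝ}
    {𝒰 : ℝ → ℝ × V × ℝ × V → ℝ} (hI : IsOpen I) (hΩ : IsOpen Ω) (hΩI : ∀ z ∈ Ω, z.2.2.1 ∈ I)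
    (hΩθ : ∀ z ∈ Ω, ∀ s, (s, z.2) ∈ Ω) (hh : ContDiffOn ℝ 2 h I) (hU : IsC02On 𝒰 Ω)
    (hUt : ∀ t, ∀ z ∈ Ω, 𝒰 (t + 2 * Real.pi) z = 𝒰 t z)
    (hUθ : ∀ t, ∀ z ∈ Ω, 𝒰 t (z.1 + 2 * Real.pi, z.2) = 𝒰 t z)
    (N : ℤ) {rN : ℝ} (hrN : deriv h rN = N) (hrN' : deriv (deriv h) rN ≠ 0)
    {θ₀ : ℝ} {q₀ p₀ : V} (h₀ : (θ₀, q₀, rN, p₀) ∈ Ω)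
    (hcrit : IsNondegenerateCriticalPoint (fun w : ℝ × V × V => 1 / (2 * Real.pi) *
      ∫ t in (0 : ℝ)..(2 * Real.pi), 𝒰 t (w.1 + N * t, w.2.1, rN, w.2.2)) (θ₀, q₀, p₀)) :
    ∃ δ : ℝ, 0 < δ ∧ ∃ (θ : ℝ → ℝ → ℝ) (q : ℝ → ℝ → V) (r : ℝ → ℝ → ℝ) (p : ℝ → ℝ → V),
      ContDiffOn ℝ 1 (fun y : ℝ × ℝ => (θ y.1 y.2, q y.1 y.2, r y.1 y.2, p y.1 y.2))
        (univ ×ˢ Ioo (-δ) δ) ∧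
      (∀ ε ∈ Ioo (-δ) δ, ∀ t, (θ t ε, q t ε, r t ε, p t ε) ∈ Ω ∧
        HasDerivAt (fun t => θ t ε)
          (deriv h (r t ε) - ε * deriv (fun s => 𝒰 t (θ t ε, q t ε, s, p t ε)) (r t ε)) t ∧
        HasDerivAt (fun t => q t ε)
          (-(ε • gradient (fun s => 𝒰 t (θ t ε, q t ε, r t ε, s)) (p t ε))) t ∧
        HasDerivAt (fun t => r t ε)
          (ε * deriv (fun s => 𝒰 t (s, q t ε, r t ε, p t ε)) (θ t ε)) t ∧
        HasDerivAt (fun t => p t ε)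
          (ε • gradient (fun s => 𝒰 t (θ t ε, s, r t ε, p t ε)) (q t ε)) t ∧
        θ (t + 2 * Real.pi) ε = θ t ε + 2 * Real.pi * N ∧ q (t + 2 * Real.pi) ε = q t ε ∧
        r (t + 2 * Real.pi) ε = r t ε ∧ p (t + 2 * Real.pi) ε = p t ε) ∧
      ∀ t, θ t 0 = θ₀ + N * t ∧ q t 0 = q₀ ∧ r t 0 = rN ∧ p t 0 = p₀ := by
  obtain ⟨δ, hδ, W, hW, hsol, hinit⟩ := exists_periodic_family_fderiv hI hΩ hΩI hΩθ hh hU hUt hUθ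
    N hrN hrN' h₀ hcrit
  refine ⟨δ, hδ, fun t ε => (W t ε).1, fun t ε => (W t ε).2.1, fun t ε => (W t ε).2.2.1,
    fun t ε => (W t ε).2.2.2, hW, fun ε hε t => ?_, fun t => ?_⟩
  · obtain ⟨hm, hd, hp⟩ := hsol ε hε t
    rw [hamiltonianField_fderiv (hU.1.differentiableAt t _ hm)] at hd
    have hd2 := hd.snd
    have hd3 := hd2.snd
    refine ⟨hm, ?_, ?_, ?_, ?_, ?_, ?_, ?_, ?_⟩
    · refine (HasFDerivAt.hasDerivAt hd.fst).congr_deriv ?_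
      simp [sub_eq_add_neg]
    · refine (HasFDerivAt.hasDerivAt hd2.fst).congr_deriv ?_
      simp
    · refine (HasFDerivAt.hasDerivAt hd3.fst).congr_deriv ?_
      simp
    · refine (HasFDerivAt.hasDerivAt hd3.snd).congr_deriv ?_
      simp
    all_goals simp only [hp]
  · simp only [hinit, and_self]

end DegenerateHamiltonian

/-! ### Smoothness of the position in Poincaré coordinates, circular motions included -/

namespace KeplerPoincare

open Filter Topology Superposition

/-- This makes the `F`-derivative of the generalized Kepler equation positive, giving both
uniqueness and the implicit function theorem. -/
theorem mul_cos_add_mul_sin_lt_one {k m : ℝ} (h : k ^ 2 + m ^ 2 < 1) (F : ℝ) :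
    k * Real.cos F + m * Real.sin F < 1 := by
  have h1 := Real.sin_sq_add_cos_sq F
  nlinarith [sq_nonneg (k - Real.cos F), sq_nonneg (m - Real.sin F)]

theorem generalized_kepler_injective {k m : ℝ} (h : k ^ 2 + m ^ 2 < 1) :
    Function.Injective fun F : ℝ => F - k * Real.sin F + m * Real.cos F := by
  refine (strictMono_of_deriv_pos fun F => ?_).injective
  have hd : HasDerivAt (fun F : ℝ => F - k * Real.sin F + m * Real.cos F)
      (1 - k * Real.cos F + m * -Real.sin F) F :=
    ((hasDerivAt_id F).sub ((Real.hasDerivAt_sin F).const_mul k)).add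
      ((Real.hasDerivAt_cos F).const_mul m)
  rw [hd.deriv]
  linarith [mul_cos_add_mul_sin_lt_one h F]

/-- Solutions of the generalized Kepler equation `F - k sin F + m cos F = λ` depend smoothly on
the data. -/
theorem contDiffAt_of_generalized_kepler {E : Type*} [NormedAddCommGroup E] [NormedSpace ℝ E]
    {n : ℕ∞} (hn : n ≠ 0) {k m lam F : E → ℝ} {z : E}
    (hk : ContDiffAt ℝ n k z) (hm : ContDiffAt ℝ n m z) (hlam : ContDiffAt ℝ n lam z)
    (hlt : ∀ᶠ y in 𝓝 z, k y ^ 2 + m y ^ 2 < 1)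
    (hF : ∀ᶠ y in 𝓝 z, F y - k y * Real.sin (F y) + m y * Real.cos (F y) = lam y) :
    ContDiffAt ℝ n F z := by
  let f : (ℝ × ℝ × ℝ) × ℝ → ℝ := fun p =>
    p.2 - p.1.1 * Real.sin p.2 + p.1.2.1 * Real.cos p.2 - p.1.2.2
  let y : E → ℝ × ℝ × ℝ := fun z => (k z, m z, lam z)
  have hn' : (n : WithTop ℕ∞) ≠ 0 := by exact_mod_cast hn
  have hy : ContDiffAt ℝ n y z := hk.prodMk (hm.prodMk hlam)
  have hf : ContDiff ℝ n f := by
    have hs : ContDiff ℝ n fun p : (ℝ × ℝ × ℝ) × ℝ => Real.sin p.2 :=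
      Real.contDiff_sin.comp contDiff_snd
    have hc : ContDiff ℝ n fun p : (ℝ × ℝ × ℝ) × ℝ => Real.cos p.2 :=
      Real.contDiff_cos.comp contDiff_snd
    fun_prop
  have hfu : ContDiffAt ℝ n f (y z, F z) := hf.contDiffAt
  have hz0 : f (y z, F z) = 0 := sub_eq_zero.2 hF.self_of_nhds
  have hinv : (fderiv ℝ f (y z, F z) ∘L .inr ℝ (ℝ × ℝ × ℝ) ℝ).IsInvertible := by
    set c : ℝ := 1 - k z * Real.cos (F z) + m z * -Real.sin (F z) with hc
    have hc0 : c ≠ 0 := by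
      have := mul_cos_add_mul_sin_lt_one hlt.self_of_nhds (F z)
      rw [hc]
      intro h
      linarith
    have h1 : HasFDerivAt (fun F => f (y z, F))
        (fderiv ℝ f (y z, F z) ∘L .inr ℝ (ℝ × ℝ × ℝ) ℝ) (F z) :=
      HasFDerivAt.comp (F z) (f := fun F => (y z, F))
        (hfu.differentiableAt hn').hasFDerivAt (hasFDerivAt_prodMk_right (y z) (F z))
    have h2 : HasDerivAt (fun F => f (y z, F)) c (F z) :=
      (((hasDerivAt_id (F z)).sub ((Real.hasDerivAt_sin (F z)).const_mul (k z))).add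
        ((Real.hasDerivAt_cos (F z)).const_mul (m z))).sub_const (lam z)
    rw [h1.unique h2.hasFDerivAt]
    refine ⟨ContinuousLinearEquiv.unitsEquivAut ℝ (Units.mk0 c hc0), ?_⟩
    ext
    simp
  have hψ := hfu.contDiffAt_implicitFunction hn' hinv
  have hψe := hfu.eventually_apply_implicitFunction hn' hinv
  rw [hz0] at hψe
  refine (ContDiffAt.comp (f := y) z hψ hy).congr_of_eventuallyEq ?_
  filter_upwards [hlt, hF, hy.continuousAt.eventually hψe] with x hx1 hx2 hx3
  -- Uniqueness identifies the given solution `F` with the implicit function, without prior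
  -- continuity of `F`.
  refine generalized_kepler_injective hx1 ?_
  simp only [f, y] at hx3
  simp only [hx2, Function.comp_apply]
  exact (sub_eq_zero.1 hx3).symm

/-- The domain of the Poincaré coordinates, in the order `(λ, η, Λ, ξ)`. -/
def orderedDomain : Set (ℝ × ℝ × ℝ × ℝ) :=
  {z | 0 < z.2.2.1 ∧ z.2.1 ^ 2 + z.2.2.2 ^ 2 < 2 * z.2.2.1}

theorem isOpen_orderedDomain : IsOpen orderedDomain :=
  (isOpen_lt (f := fun _ => 0) (g := fun z : ℝ × ℝ × ℝ × ℝ => z.2.2.1) (by fun_prop)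
    (by fun_prop)).inter
    (isOpen_lt (f := fun z : ℝ × ℝ × ℝ × ℝ => z.2.1 ^ 2 + z.2.2.2 ^ 2)
      (g := fun z => 2 * z.2.2.1) (by fun_prop) (by fun_prop))

/-- The ratio between the eccentricity and `√(2H)`. -/
noncomputable def eccentricityFactor (Lam eta xi : ℝ) : ℝ :=
  √(1 / Lam - (eta ^ 2 + xi ^ 2) / (4 * Lam ^ 2))

/-- The eccentric longitude `u + g`. -/
noncomputable def eccentricLongitude (lam Lam eta xi : ℝ) : ℝ :=
  eccentricAnomaly (√(1 - ((Lam - (eta ^ 2 + xi ^ 2) / 2) / Lam) ^ 2))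
    (lam + Complex.arg ⟨xi, eta⟩) - Complex.arg ⟨xi, eta⟩

section

variable {Lam eta xi : ℝ}

theorem eccentricityFactor_arg_pos (hL : 0 < Lam) (hd : eta ^ 2 + xi ^ 2 < 2 * Lam) :
    0 < 1 / Lam - (eta ^ 2 + xi ^ 2) / (4 * Lam ^ 2) := by
  have h : 1 / Lam - (eta ^ 2 + xi ^ 2) / (4 * Lam ^ 2) =
      (4 * Lam - (eta ^ 2 + xi ^ 2)) / (4 * Lam ^ 2) := by field_simp
  rw [h]
  apply div_pos <;> nlinarith

/-- With `2H = η² + ξ²`, `e² = 1 - (1 - H/Λ)² = 2H (1/Λ - H/(2Λ²))`. The second factor stays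
positive on the domain, so its root is smooth, whereas `√(2H)` is not at the origin. -/
theorem eccentricity_eq (hL : 0 < Lam) (hd : eta ^ 2 + xi ^ 2 < 2 * Lam) :
    √(1 - ((Lam - (eta ^ 2 + xi ^ 2) / 2) / Lam) ^ 2) =
      ‖(⟨xi, eta⟩ : ℂ)‖ * eccentricityFactor Lam eta xi := by
  have hpos := eccentricityFactor_arg_pos hL hd
  rw [Complex.norm_def, Complex.normSq_mk, eccentricityFactor,
    ← Real.sqrt_mul (by nlinarith [sq_nonneg xi, sq_nonneg eta])]
  congr 1
  field_simp
  ring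

theorem eccentricity_mul_cos (hL : 0 < Lam) (hd : eta ^ 2 + xi ^ 2 < 2 * Lam) :
    √(1 - ((Lam - (eta ^ 2 + xi ^ 2) / 2) / Lam) ^ 2) * Real.cos (Complex.arg ⟨xi, eta⟩) =
      xi * eccentricityFactor Lam eta xi := by
  rw [eccentricity_eq hL hd, mul_right_comm, Complex.norm_mul_cos_arg]

theorem eccentricity_mul_sin (hL : 0 < Lam) (hd : eta ^ 2 + xi ^ 2 < 2 * Lam) :
    √(1 - ((Lam - (eta ^ 2 + xi ^ 2) / 2) / Lam) ^ 2) * Real.sin (Complex.arg ⟨xi, eta⟩) =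
      eta * eccentricityFactor Lam eta xi := by
  rw [eccentricity_eq hL hd, mul_right_comm, Complex.norm_mul_sin_arg]

theorem ratio_pos_and_le_one (hL : 0 < Lam) (hd : eta ^ 2 + xi ^ 2 < 2 * Lam) :
    0 < (Lam - (eta ^ 2 + xi ^ 2) / 2) / Lam ∧ (Lam - (eta ^ 2 + xi ^ 2) / 2) / Lam ≤ 1 := by
  refine ⟨div_pos (by linarith) hL, (div_le_one hL).2 ?_⟩
  nlinarith [sq_nonneg xi, sq_nonneg eta]

theorem eccentricity_lt_one (hL : 0 < Lam) (hd : eta ^ 2 + xi ^ 2 < 2 * Lam) :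
    √(1 - ((Lam - (eta ^ 2 + xi ^ 2) / 2) / Lam) ^ 2) < 1 := by
  obtain ⟨h0, h1⟩ := ratio_pos_and_le_one hL hd
  rw [Real.sqrt_lt' one_pos]
  nlinarith

theorem sq_add_sq_lt_one (hL : 0 < Lam) (hd : eta ^ 2 + xi ^ 2 < 2 * Lam) :
    (xi * eccentricityFactor Lam eta xi) ^ 2 + (-eta * eccentricityFactor Lam eta xi) ^ 2 < 1 := by
  rw [neg_mul, ← eccentricity_mul_cos hL hd, ← eccentricity_mul_sin hL hd, neg_sq, mul_pow,
    mul_pow, ← mul_add, Real.cos_sq_add_sin_sq, mul_one]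
  have := eccentricity_lt_one hL hd
  nlinarith [Real.sqrt_nonneg (1 - ((Lam - (eta ^ 2 + xi ^ 2) / 2) / Lam) ^ 2)]

/-- Substitute `u = F + h` in Kepler's equation and expand the sine: the angle `h` survives only in
`e cos h` and `e sin h`. -/
theorem eccentricLongitude_spec (lam : ℝ) (hL : 0 < Lam) (hd : eta ^ 2 + xi ^ 2 < 2 * Lam) :
    eccentricLongitude lam Lam eta xi -
      xi * eccentricityFactor Lam eta xi * Real.sin (eccentricLongitude lam Lam eta xi) +
      -eta * eccentricityFactor Lam eta xi * Real.cos (eccentricLongitude lam Lam eta xi) =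
      lam := by
  have hu := eccentricAnomaly_spec (Real.sqrt_nonneg _) (eccentricity_lt_one hL hd)
    (lam + Complex.arg ⟨xi, eta⟩)
  rw [neg_mul, ← eccentricity_mul_cos hL hd, ← eccentricity_mul_sin hL hd, eccentricLongitude]
  set e := √(1 - ((Lam - (eta ^ 2 + xi ^ 2) / 2) / Lam) ^ 2)
  set g := Complex.arg ⟨xi, eta⟩
  set u := eccentricAnomaly e (lam + g)
  have h := Real.sin_sq_add_cos_sq g
  rw [Real.sin_sub, Real.cos_sub]
  linear_combination hu - e * Real.sin u * h

/-- The position as a function of the eccentric longitude and of `e cos g`, `e sin g`. -/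
theorem position_eq (lam : ℝ) (hL : 0 < Lam) (hd : eta ^ 2 + xi ^ 2 < 2 * Lam) :
    position lam Lam eta xi =
      !₂[Lam ^ 2 * (Real.cos (eccentricLongitude lam Lam eta xi) -
          (eccentricityFactor Lam eta xi ^ 2 / (2 - (eta ^ 2 + xi ^ 2) / 2 / Lam)) *
          (xi * eta * Real.sin (eccentricLongitude lam Lam eta xi) +
            eta ^ 2 * Real.cos (eccentricLongitude lam Lam eta xi)) -
          xi * eccentricityFactor Lam eta xi),
        Lam ^ 2 * (Real.sin (eccentricLongitude lam Lam eta xi) -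
          (eccentricityFactor Lam eta xi ^ 2 / (2 - (eta ^ 2 + xi ^ 2) / 2 / Lam)) *
          (xi ^ 2 * Real.sin (eccentricLongitude lam Lam eta xi) +
            xi * eta * Real.cos (eccentricLongitude lam Lam eta xi)) +
          eta * eccentricityFactor Lam eta xi)] := by
  have hc := eccentricity_mul_cos hL hd
  have hs := eccentricity_mul_sin hL hd
  obtain ⟨h0, h1⟩ := ratio_pos_and_le_one hL hd
  simp only [position, delaunayPosition, ellipsePosition, sub_neg_eq_add, eccentricLongitude]
  have hden : 2 - (eta ^ 2 + xi ^ 2) / 2 / Lam = 1 + (Lam - (eta ^ 2 + xi ^ 2) / 2) / Lam := by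
    field_simp
    ring
  have he2 : √(1 - ((Lam - (eta ^ 2 + xi ^ 2) / 2) / Lam) ^ 2) ^ 2 =
      1 - ((Lam - (eta ^ 2 + xi ^ 2) / 2) / Lam) ^ 2 := Real.sq_sqrt (by nlinarith)
  rw [hden, he2]
  set s := (Lam - (eta ^ 2 + xi ^ 2) / 2) / Lam
  set e := √(1 - s ^ 2)
  -- Here `g` abbreviates the angle `h`, the opposite of the argument of the pericenter, and `s =
  -- √(1 - e²)`.
  set g := Complex.arg ⟨xi, eta⟩
  set σ := eccentricityFactor Lam eta xi
  set u := eccentricAnomaly e (lam + g)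
  have hss : √(1 - (1 - s ^ 2)) = s := by
    rw [sub_sub_cancel, Real.sqrt_sq h0.le]
  have hse : ∀ x y, σ ^ 2 / (1 + s) * (x * y) = (x * σ) * (y * σ) / (1 + s) := fun x y => by ring
  -- From `1 - s = e² / (1 + s)`: the products of sines and cosines left by the rotation carry the
  -- factor `1 - s`, hence are smooth in `(Λ, η, ξ)`.
  have k1 : σ ^ 2 / (1 + s) * (xi * eta) = (1 - s) * (Real.cos g * Real.sin g) := by
    rw [hse, ← hc, ← hs, div_eq_iff (by linarith)]
    linear_combination (Real.cos g * Real.sin g) * he2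
  have k2 : σ ^ 2 / (1 + s) * eta ^ 2 = (1 - s) * Real.sin g ^ 2 := by
    rw [sq eta, hse, ← hs, div_eq_iff (by linarith)]
    linear_combination (Real.sin g ^ 2) * he2
  have k3 : σ ^ 2 / (1 + s) * xi ^ 2 = (1 - s) * Real.cos g ^ 2 := by
    rw [sq xi, hse, ← hc, div_eq_iff (by linarith)]
    linear_combination (Real.cos g ^ 2) * he2
  have hg := Real.sin_sq_add_cos_sq g
  rw [hss, Real.cos_neg, Real.sin_neg, Real.cos_sub, Real.sin_sub]
  congr 2
  · linear_combination Lam ^ 2 * (Real.sin u * Real.cos g - Real.cos u * Real.sin g) * k1 +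
      Lam ^ 2 * (Real.cos u * Real.cos g + Real.sin u * Real.sin g) * k2 - Lam ^ 2 * hc +
      Lam ^ 2 * (1 - s) * Real.sin u * Real.sin g * hg
  · congr 1
    linear_combination Lam ^ 2 * (Real.sin u * Real.cos g - Real.cos u * Real.sin g) * k3 +
      Lam ^ 2 * (Real.cos u * Real.cos g + Real.sin u * Real.sin g) * k1 + Lam ^ 2 * hs +
      Lam ^ 2 * (1 - s) * Real.cos g * Real.sin u * hg

end

/-- In `position_eq` the discontinuous angle `Complex.arg` occurs only through the eccentric
longitude, smooth by the generalized Kepler equation. -/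
theorem contDiffOn_position {n : ℕ∞} (hn : n ≠ 0) :
    ContDiffOn ℝ n (fun z : ℝ × ℝ × ℝ × ℝ => position z.1 z.2.2.1 z.2.1 z.2.2.2)
      orderedDomain := by
  intro z hz
  apply ContDiffAt.contDiffWithinAt
  have hev := isOpen_orderedDomain.eventually_mem hz
  have hL : z.2.2.1 ≠ 0 := hz.1.ne'
  have hσ : ContDiffAt ℝ n (fun z : ℝ × ℝ × ℝ × ℝ =>
      eccentricityFactor z.2.2.1 z.2.1 z.2.2.2) z := by
    refine ContDiffAt.sqrt ?_ (eccentricityFactor_arg_pos hz.1 hz.2).ne'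
    refine ContDiffAt.sub (contDiffAt_const.div (by fun_prop) hL)
      (ContDiffAt.div (by fun_prop) (by fun_prop) (by positivity))
  have hF : ContDiffAt ℝ n (fun z : ℝ × ℝ × ℝ × ℝ =>
      eccentricLongitude z.1 z.2.2.1 z.2.1 z.2.2.2) z :=
    contDiffAt_of_generalized_kepler (lam := fun z : ℝ × ℝ × ℝ × ℝ => z.1)
      (k := fun z : ℝ × ℝ × ℝ × ℝ => z.2.2.2 * eccentricityFactor z.2.2.1 z.2.1 z.2.2.2)
      (m := fun z : ℝ × ℝ × ℝ × ℝ => -z.2.1 * eccentricityFactor z.2.2.1 z.2.1 z.2.2.2) hn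
      (ContDiffAt.mul (by fun_prop) hσ) (ContDiffAt.mul (by fun_prop) hσ) (by fun_prop)
      (hev.mono fun y hy => sq_add_sq_lt_one hy.1 hy.2)
      (hev.mono fun y hy => eccentricLongitude_spec y.1 hy.1 hy.2)
  have hcF := hF.cos
  have hsF := hF.sin
  have hden : ContDiffAt ℝ n (fun z : ℝ × ℝ × ℝ × ℝ =>
      eccentricityFactor z.2.2.1 z.2.1 z.2.2.2 ^ 2 /
        (2 - (z.2.1 ^ 2 + z.2.2.2 ^ 2) / 2 / z.2.2.1)) z := by
    refine (hσ.pow 2).div (contDiffAt_const.sub (ContDiffAt.div (by fun_prop) (by fun_prop) hL)) ?_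
    have h1 : (z.2.1 ^ 2 + z.2.2.2 ^ 2) / 2 / z.2.2.1 < 1 := by
      rw [div_lt_one hz.1]
      linarith [hz.2]
    linarith
  refine ContDiffAt.congr_of_eventuallyEq ?_ (hev.mono fun y hy => position_eq y.1 hy.1 hy.2)
  rw [contDiffAt_piLp]
  intro i
  fin_cases i
  · refine ContDiffAt.mul (by fun_prop) ((hcF.sub (hden.mul (ContDiffAt.add
      (ContDiffAt.mul (by fun_prop) hsF) (ContDiffAt.mul (by fun_prop) hcF)))).sub
      (ContDiffAt.mul (by fun_prop) hσ))
  · refine ContDiffAt.mul (by fun_prop) ((hsF.sub (hden.mul (ContDiffAt.add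
      (ContDiffAt.mul (by fun_prop) hsF) (ContDiffAt.mul (by fun_prop) hcF)))).add
      (ContDiffAt.mul (by fun_prop) hσ))

end KeplerPoincare

/-! ### The Kepler problem as a degenerate Hamiltonian system -/

namespace KeplerPoincare

open Filter Topology Superposition

/-- By uniqueness in the generalized Kepler equation, the eccentric longitude also grows by `2π`. -/
theorem position_add_two_pi (lam : ℝ) {Lam eta xi : ℝ} (hL : 0 < Lam)
    (hd : eta ^ 2 + xi ^ 2 < 2 * Lam) :
    position (lam + 2 * Real.pi) Lam eta xi = position lam Lam eta xi := by
  have h : eccentricLongitude (lam + 2 * Real.pi) Lam eta xi =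
      eccentricLongitude lam Lam eta xi + 2 * Real.pi := by
    refine generalized_kepler_injective (sq_add_sq_lt_one hL hd) ?_
    simp only [Real.sin_add_two_pi, Real.cos_add_two_pi]
    linarith [eccentricLongitude_spec lam hL hd, eccentricLongitude_spec (lam + 2 * Real.pi) hL hd]
  rw [position_eq _ hL hd, position_eq _ hL hd, h, Real.sin_add_two_pi, Real.cos_add_two_pi]

/-- The Kepler Hamiltonian `-1 / (2Λ²)`. -/
noncomputable def keplerEnergy (Lam : ℝ) : ℝ := -(1 / (2 * Lam ^ 2))

theorem deriv_keplerEnergy {r : ℝ} (hr : 0 < r) : deriv keplerEnergy r = 1 / r ^ 3 := by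
  have h : HasDerivAt keplerEnergy (-((0 * (2 * r ^ 2) - 1 * (2 * (2 * r))) / (2 * r ^ 2) ^ 2))
      r := by
    have h1 : HasDerivAt (fun r : ℝ => 2 * r ^ 2) (2 * (2 * r)) r := by
      simpa using (hasDerivAt_pow 2 r).const_mul 2
    exact ((hasDerivAt_const r (1 : ℝ)).div h1 (by positivity)).neg
  rw [h.deriv]
  field_simp
  ring

theorem deriv_deriv_keplerEnergy {r : ℝ} (hr : 0 < r) :
    deriv (deriv keplerEnergy) r ≠ 0 := by
  have h1 : deriv keplerEnergy =ᶠ[𝓝 r] fun r => 1 / r ^ 3 := by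
    filter_upwards [lt_mem_nhds hr] with x hx using deriv_keplerEnergy hx
  have h2 : HasDerivAt (fun r : ℝ => 1 / r ^ 3) ((0 * r ^ 3 - 1 * (3 * r ^ 2)) / (r ^ 3) ^ 2) r := by
    exact (hasDerivAt_const r (1 : ℝ)).div (by simpa using hasDerivAt_pow 3 r) (by positivity)
  rw [h1.deriv_eq, h2.deriv, zero_mul, one_mul, zero_sub]
  exact div_ne_zero (neg_ne_zero.2 (by positivity)) (by positivity)

theorem contDiffOn_keplerEnergy : ContDiffOn ℝ 2 keplerEnergy (Ioi 0) := by
  intro r hr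
  have hr' : 2 * r ^ 2 ≠ 0 := by
    have : (0 : ℝ) < r := hr
    positivity
  have h : ContDiff ℝ 2 fun r : ℝ => 2 * r ^ 2 := by fun_prop
  exact (contDiffAt_const.div h.contDiffAt hr').neg.contDiffWithinAt

theorem exists_periodic_solutions (U : ℝ → EuclideanSpace ℝ (Fin 2) → ℝ)
    (hU : DegenerateHamiltonian.IsC03On U univ)
    (hUt : ∀ t x, U (t + 2 * Real.pi) x = U t x)
    (N : ℕ) (hN : 1 ≤ N) (lam₀ eta₀ xi₀ : ℝ)
    (h₀ : eta₀ ^ 2 + xi₀ ^ 2 < 2 / (N : ℝ) ^ (1 / 3 : ℝ))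
    (hcrit : DegenerateHamiltonian.IsNondegenerateCriticalPoint (gammaN U N) (lam₀, eta₀, xi₀)) :
    ∃ δ : ℝ, 0 < δ ∧ ∃ lam Lam eta xi : ℝ → ℝ → ℝ,
      ContDiffOn ℝ 1 (fun y : ℝ × ℝ => (lam y.1 y.2, Lam y.1 y.2, eta y.1 y.2, xi y.1 y.2))
        (univ ×ˢ Ioo (-δ) δ) ∧
      (∀ ε ∈ Ioo (-δ) δ,
        IsSolution U ε (fun t => lam t ε) (fun t => Lam t ε) (fun t => eta t ε)
          (fun t => xi t ε) ∧
        ∀ t, lam (t + 2 * Real.pi) ε = lam t ε + 2 * Real.pi * N ∧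
          Lam (t + 2 * Real.pi) ε = Lam t ε ∧
          eta (t + 2 * Real.pi) ε = eta t ε ∧
          xi (t + 2 * Real.pi) ε = xi t ε) ∧
      ∀ t, lam t 0 = N * t + lam₀ ∧ Lam t 0 = 1 / (N : ℝ) ^ (1 / 3 : ℝ) ∧
        eta t 0 = eta₀ ∧ xi t 0 = xi₀ := by
  have hN0 : (0 : ℝ) < N := by exact_mod_cast hN
  set rN : ℝ := 1 / (N : ℝ) ^ (1 / 3 : ℝ) with hrN
  have hrN0 : 0 < rN := by positivity
  have hrN3 : deriv keplerEnergy rN = ((N : ℤ) : ℝ) := by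
    have h3 : ((N : ℝ) ^ (1 / 3 : ℝ)) ^ 3 = N := by
      rw [← Real.rpow_natCast, ← Real.rpow_mul hN0.le]
      norm_num
    rw [deriv_keplerEnergy hrN0, hrN, div_pow, h3]
    simp
  have hC02 : IsC02On (fun t (z : ℝ × ℝ × ℝ × ℝ) => potential U t z.1 z.2.2.1 z.2.1 z.2.2.2)
      orderedDomain :=
    (hU.isC02On isOpen_univ).comp_contDiffOn isOpen_orderedDomain
      (contDiffOn_position two_ne_zero) fun _ _ => mem_univ _
  obtain ⟨δ, hδ, lam, eta, Lam, xi, hC1, hsol, hinit⟩ :=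
    -- The roles are `θ = λ`, `q = η`, `r = Λ`, `p = ξ`. Taking `V = ℝ` turns gradients into
    -- ordinary derivatives.
    DegenerateHamiltonian.exists_periodic_solutions (V := ℝ) (I := Ioi 0) isOpen_Ioi
      isOpen_orderedDomain (fun z hz => hz.1) (fun z hz s => hz) contDiffOn_keplerEnergy hC02
      (fun t z _ => hUt t _)
      (fun t z hz => congrArg (U t) (position_add_two_pi z.1 hz.1 hz.2)) (N : ℤ) hrN3
      (deriv_deriv_keplerEnergy hrN0) (θ₀ := lam₀) (q₀ := eta₀) (p₀ := xi₀)
      ⟨hrN0, by simpa [hrN, div_eq_mul_inv] using h₀⟩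
      (by
        convert hcrit using 1
        funext w
        simp only [gammaN, Int.cast_natCast, add_comm w.1]
        rfl)
  refine ⟨δ, hδ, lam, Lam, eta, xi, ?_, fun ε hε => ⟨⟨fun t => ?_, fun t => ?_, fun t => ?_,
    fun t => ?_, fun t => ?_⟩, fun t => ?_⟩, fun t => ?_⟩
  · have hperm : ContDiff ℝ 1 fun z : ℝ × ℝ × ℝ × ℝ => (z.1, z.2.2.1, z.2.1, z.2.2.2) := by
      fun_prop
    exact hperm.comp_contDiffOn hC1
  · exact (hsol ε hε t).1
  · obtain ⟨hm, h1, -⟩ := hsol ε hε t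
    rwa [deriv_keplerEnergy hm.1] at h1
  · exact (hsol ε hε t).2.2.2.1
  · have h1 := (hsol ε hε t).2.2.1
    rwa [gradient_eq_deriv'] at h1
  · have h1 := (hsol ε hε t).2.2.2.2.1
    rwa [gradient_eq_deriv'] at h1
  · obtain ⟨-, -, -, -, -, h1, h2, h3, h4⟩ := hsol ε hε t
    exact ⟨by simpa using h1, h3, h2, h4⟩
  · obtain ⟨h1, h2, h3, h4⟩ := hinit t
    exact ⟨by rw [h1, Int.cast_natCast, add_comm], h3, h2, h4⟩

end KeplerPoincare

/-! ### Both statements together -/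

theorem proposition4p1 :
    -- the perturbed Kepler problem in Poincaré coordinates
    (∀ (U : ℝ → EuclideanSpace ℝ (Fin 2) → ℝ),
      DegenerateHamiltonian.IsC03On U Set.univ →
      (∀ t x, U (t + 2 * Real.pi) x = U t x) →
      ∀ (N : ℕ), 1 ≤ N →
      ∀ (lam₀ eta₀ xi₀ : ℝ), eta₀ ^ 2 + xi₀ ^ 2 < 2 / (N : ℝ) ^ (1 / 3 : ℝ) →
      DegenerateHamiltonian.IsNondegenerateCriticalPoint
        (KeplerPoincare.gammaN U N) (lam₀, eta₀, xi₀) →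
      ∃ δ : ℝ, 0 < δ ∧ ∃ lam Lam eta xi : ℝ → ℝ → ℝ,
        ContDiffOn ℝ 1 (fun y : ℝ × ℝ => (lam y.1 y.2, Lam y.1 y.2, eta y.1 y.2, xi y.1 y.2))
          (Set.univ ×ˢ Set.Ioo (-δ) δ) ∧
        (∀ ε ∈ Set.Ioo (-δ) δ,
          KeplerPoincare.IsSolution U ε
            (fun t => lam t ε) (fun t => Lam t ε) (fun t => eta t ε) (fun t => xi t ε) ∧
          ∀ t, lam (t + 2 * Real.pi) ε = lam t ε + 2 * Real.pi * N ∧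
            Lam (t + 2 * Real.pi) ε = Lam t ε ∧
            eta (t + 2 * Real.pi) ε = eta t ε ∧
            xi (t + 2 * Real.pi) ε = xi t ε) ∧
        ∀ t, lam t 0 = N * t + lam₀ ∧ Lam t 0 = 1 / (N : ℝ) ^ (1 / 3 : ℝ) ∧
          eta t 0 = eta₀ ∧ xi t 0 = xi₀) ∧
    -- general degenerate Hamiltonians `h(r) - ε 𝒰(t, θ, q, r, p)`
    (∀ (d : ℕ) (I : Set ℝ)
      (D : ℝ → Set (EuclideanSpace ℝ (Fin d) × EuclideanSpace ℝ (Fin d)))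
      (h : ℝ → ℝ) (𝒰 : ℝ → DegenerateHamiltonian.Phase d → ℝ),
      IsOpen I → I.OrdConnected → IsOpen (DegenerateHamiltonian.phaseSpace I D) →
      ContDiffOn ℝ 3 h I →
      DegenerateHamiltonian.IsC03On 𝒰 (DegenerateHamiltonian.phaseSpace I D) →
      (∀ t, ∀ z ∈ DegenerateHamiltonian.phaseSpace I D, 𝒰 (t + 2 * Real.pi) z = 𝒰 t z) →
      (∀ t, ∀ z ∈ DegenerateHamiltonian.phaseSpace I D,
        𝒰 t (z.1 + 2 * Real.pi, z.2) = 𝒰 t z) →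
      ∀ (N : ℤ) (rN : ℝ), rN ∈ I → deriv h rN = N → deriv (deriv h) rN ≠ 0 →
      ∀ (θ₀ : ℝ) (q₀ p₀ : EuclideanSpace ℝ (Fin d)), (q₀, p₀) ∈ D rN →
      DegenerateHamiltonian.IsNondegenerateCriticalPoint
        (DegenerateHamiltonian.averaged 𝒰 N rN) (θ₀, q₀, p₀) →
      ∃ δ : ℝ, 0 < δ ∧ ∃ (θ : ℝ → ℝ → ℝ) (q : ℝ → ℝ → EuclideanSpace ℝ (Fin d))
          (r : ℝ → ℝ → ℝ) (p : ℝ → ℝ → EuclideanSpace ℝ (Fin d)),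
        ContDiffOn ℝ 1 (fun y : ℝ × ℝ => (θ y.1 y.2, q y.1 y.2, r y.1 y.2, p y.1 y.2))
          (Set.univ ×ˢ Set.Ioo (-δ) δ) ∧
        (∀ ε ∈ Set.Ioo (-δ) δ,
          DegenerateHamiltonian.IsSolution (DegenerateHamiltonian.phaseSpace I D) h 𝒰 ε
            (fun t => θ t ε) (fun t => q t ε) (fun t => r t ε) (fun t => p t ε) ∧
          ∀ t, θ (t + 2 * Real.pi) ε = θ t ε + 2 * Real.pi * N ∧
            q (t + 2 * Real.pi) ε = q t ε ∧
            r (t + 2 * Real.pi) ε = r t ε ∧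
            p (t + 2 * Real.pi) ε = p t ε) ∧
        ∀ t, θ t 0 = θ₀ + N * t ∧ q t 0 = q₀ ∧ r t 0 = rN ∧ p t 0 = p₀) := by
  refine ⟨KeplerPoincare.exists_periodic_solutions, ?_⟩
  intro d I D h 𝒰 hI _ hΩ hh hU hUt hUθ N rN hrI hrN hrN' θ₀ q₀ p₀ h₀ hcrit
  obtain ⟨δ, hδ, θ, q, r, p, hC1, hsol, hinit⟩ :=
    DegenerateHamiltonian.exists_periodic_solutions hI hΩ (fun z hz => hz.1)
      (fun z hz s => hz) (hh.of_le (by norm_num)) (hU.isC02On hΩ) hUt hUθ N hrN hrN'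
      (θ₀ := θ₀) (q₀ := q₀) (p₀ := p₀) ⟨hrI, h₀⟩ hcrit
  exact ⟨δ, hδ, θ, q, r, p, hC1, fun ε hε =>
    ⟨⟨fun t => (hsol ε hε t).1, fun t => (hsol ε hε t).2.1, fun t => (hsol ε hε t).2.2.1,
      fun t => (hsol ε hε t).2.2.2.1, fun t => (hsol ε hε t).2.2.2.2.1⟩,
      fun t => (hsol ε hε t).2.2.2.2.2⟩, hinit⟩
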